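/- Let $m, D$ be positive integers, $D\neq 1$ squarefree, and $F=\mathbb{Q}(\sqrt{D})$ with ring of integers $\mathcal{O}_F$. Let $\Delta_D=D$ if $D\equiv 1\pmod 4$ and $\Delta_D=4D$ otherwise (the discriminant of $F$). An element of $F$ is totally positive if it is positive under both embeddings of $F$ into $\mathbb{R}$; let $\mathcal{O}_F^+$ be the set of totally positive elements of $\mathcal{O}_F$. For an odd prime $p$ let $\gamma_p$ be the least positive quadratic non-residue modulo $p$, and put $\gamma_2=7$. Let $(V,Q)$ be a quadratic space over $F$ and let $L$ be a finitely generated $\mathcal{O}_F$-submodule of $V$ with $Q(L)\subseteq\mathcal{O}_F$. Write $\operatorname{rank} L$ for the dimension of the $F$-span $FL$ of $L$. Assume that $L$ is classical, i.e. $\frac12\bigl(Q(v+w)-Q(v)-Q(w)\bigr)\in\mathcal{O}_F$ for all $v,w\in L$; that $L$ is totally positive definite, i.e. $Q(x)$ is totally positive for every nonzero $x\in FL$; and that $L$ represents every element of $m\mathcal{O}_F^+$, i.e. for each $\alpha\in\mathcal{O}_F^+$ there is $v\in L$ with $Q(v)=m\alpha$. Then there exist primes $p_1,p_2\le 2m^2$,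 integers $C_1,C_2$ with $2\le C_i\le\gamma_{p_i}$, primes $q_1,q_2$ with $q_i\le 2C_im^3$, and integers $D_1,D_2$ with $1\le D_i\le q_i\gamma_{q_i}$ ($i=1,2$), such that all of the following hold: \begin{enumerate} \item If $\operatorname{rank} L\leq 3$, then $\sqrt{\Delta_{D}} < 5C_{1}m^2$. \item If $\operatorname{rank} L\leq 4$, then $\sqrt{\Delta_{D}} < 9C_1m^2$. \item If $\operatorname{rank} L\leq 5$, then $\sqrt{\Delta_{D}} < 45 C_{2}m^3$. \item If $\operatorname{rank} L\leq 6$, then $\sqrt{\Delta_{D}} < \max\bigl\{45 C_{2}m^3,\; 5D_{1}\max\{C_{1},C_{2}\} m^2\bigr\}$. \item If $\operatorname{rank} L\leq 7$, then $\sqrt{\Delta_{D}} <\max\bigl\{5\max\{C_{1},D_{1}\}\max\{C_{2},D_{2}\}m^2,\; 200C_{2}D_{2}m^4\bigr\}$. \end{enumerate} -/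

import Mathlib

open NumberField IntermediateField

noncomputable section

/-- The field `ℚ(√D)`, realised inside `ℝ`. -/
abbrev QuadField (D : ℕ) : IntermediateField ℚ ℝ := ℚ⟮√(D : ℝ)⟯

/-- The number `Δ_D`: it is `D` if `D ≡ 1 (mod 4)` and `4D` otherwise. For squarefree `D ≠ 1`
it is the discriminant of `ℚ(√D)`. -/
def quadDisc (D : ℕ) : ℕ := if D % 4 = 1 then D else 4 * D

/-- The number `γ_p`: the least quadratic non-residue modulo `p` if `p` is an odd prime (in this
case `0` is a square modulo `p`, so the least one is positive), and `γ_2 = 7`. -/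
def leastNonresidue (p : ℕ) : ℕ :=
  if p = 2 then 7 else sInf {n : ℕ | ¬ IsSquare (n : ZMod p)}

/-- An element of a totally real field is totally positive if it is positive in
every embedding of the field into `ℝ`. -/
def IsTotallyPos {F : Type*} [Field F] (α : F) : Prop := ∀ σ : F →+* ℝ, 0 < σ α

/-- A quadratic `𝓞 F`-lattice in a quadratic space `(V, Q)` over `F`: a finitely generated
`𝓞 F`-submodule `L` of `V` with `Q(L) ⊆ 𝓞 F`. It need not span `V`. -/
structure QuadLattice (F : Type*) [Field F] {V : Type*} [AddCommGroup V] [Module F V]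
    [Module (𝓞 F) V] (Q : QuadraticForm F V) where
  /-- The underlying module. -/
  toSubmodule : Submodule (𝓞 F) V
  fg : toSubmodule.FG
  integral : ∀ v ∈ toSubmodule, ∃ a : 𝓞 F, Q v = (a : F)

namespace QuadLattice

variable {F : Type*} [Field F] {V : Type*} [AddCommGroup V] [Module F V] [Module (𝓞 F) V]
  {Q : QuadraticForm F V}

/-- The quadratic space `F L`, i.e. the `F`-linear span of `L` in `V`
(canonically isomorphic to `L ⊗ F`). -/
def space (L : QuadLattice F Q) : Submodule F V := Submodule.span F (L.toSubmodule : Set V)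

/-- The rank of `L`: the dimension of its quadratic space. -/
def rank (L : QuadLattice F Q) : ℕ := Module.finrank F L.space

/-- `L` is classical if the bilinear form `B(v, w) = (Q(v + w) - Q(v) - Q(w)) / 2` takes
integral values on `L`. -/
def IsClassical (L : QuadLattice F Q) : Prop :=
  ∀ v ∈ L.toSubmodule, ∀ w ∈ L.toSubmodule, ∃ b : 𝓞 F, (Q (v + w) - Q v - Q w) / 2 = (b : F)

/-- `L` is totally positive definite if its quadratic space is. -/
def IsTotallyPosDef (L : QuadLattice F Q) : Prop := ∀ x ∈ L.space, x ≠ 0 → IsTotallyPos (Q x)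

/-- `L` represents `α` if `Q(v) = α` for some `v ∈ L`. -/
def Represents (L : QuadLattice F Q) (α : F) : Prop := ∃ v ∈ L.toSubmodule, Q v = α

end QuadLattice

end

/-! Let s = √Δ_D, and let α be a totally positive integer of F with α − α' = s and 0 < α' ≤ 1. The
lattice contains vectors f(n) with Q = mn and g(n) with Q = mnα. An integer of F differs from its
conjugate by an element of sℤ. So when s is large, Cauchy–Schwarz in both embeddings forces the
products B(f(n), f(k)) and B(f(n), g(k)) to be rational, while B(g(n), g(k)) minus its conjugate is
s·y(n, k) for an integral symmetric matrix Y with diagonal entries mn. The two real Gram matrices of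
the whole system thus differ only by sY in the g-block. If the f-block is nonsingular and Y is
positive definite, all the vectors are independent (`linearIndependent_sumElim`). Using 3+1, 3+2,
3+3, 4+3 and 4+4 vectors gives the five bounds.

The indices are 1, 2, C, D, chosen separately for the f-block and for Y. A singular 3 × 3 matrix
would make C a value of a form ⟨1, e⟩ over ℚ; a non-residue modulo an odd prime dividing the
squarefree part of e, or else 3 or 5, prevents this (`exists_not_eq_binary`). A singular 4 × 4
matrix would make D a value of a positive definite form ⟨1, e, eg⟩. By Legendre's descent this form
is anisotropic over some ℚ_q, where it misses the square class of minus its discriminant, and D is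
taken from that class (`exists_not_eq_ternary`).

For the definiteness of Y, write sY = G − H with G positive semidefinite and H bounded. The rescaled
eigenvalues of Y are then at least −O(m/s). A nonzero integral determinant is too large to allow an
eigenvalue between this bound and 0 (`posDef_intCast_fin_three`, `posDef_intCast_fin_four`). -/

/-! ### Ternary forms over ℚ_q and Legendre's descent -/

/-- The equation `x² = a y² + b z²` has a nontrivial solution in `K`. -/
def TernaryIsotropic (K : Type*) [Field K] (a b : K) : Prop :=
  ∃ x y z : K, (x ≠ 0 ∨ y ≠ 0 ∨ z ≠ 0) ∧ x ^ 2 = a * y ^ 2 + b * z ^ 2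

namespace TernaryIsotropic

variable {K : Type*} [Field K] {a b : K}

theorem symm (h : TernaryIsotropic K a b) : TernaryIsotropic K b a := by
  obtain ⟨x, y, z, hne, h⟩ := h
  exact ⟨x, z, y, by tauto, by rw [h]; ring⟩

/-- Norms from K(√a) multiply: (x² − a y²)(t² − a) is c times the square of b z. The descent uses
this to trade `b` for `c`. -/
theorem of_norm_eq_mul (h : TernaryIsotropic K a b) (hb : b ≠ 0) {c t : K}
    (ht : t ^ 2 - a = b * c) : TernaryIsotropic K a c := by
  obtain ⟨x, y, z, hne, h⟩ := h
  by_cases hz : z = 0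
  · refine ⟨x, y, 0, by simpa [hz] using hne, by rw [h, hz]; ring⟩
  · refine ⟨x * t + a * y, x + t * y, b * z, Or.inr (Or.inr (mul_ne_zero hb hz)), ?_⟩
    linear_combination (t ^ 2 - a) * h + b * z ^ 2 * ht

theorem of_mul_sq {k : K} (h : TernaryIsotropic K a (k ^ 2 * b)) (hk : k ≠ 0) :
    TernaryIsotropic K a b := by
  obtain ⟨x, y, z, hne, h⟩ := h
  refine ⟨x, y, k * z, ?_, by rw [h]; ring⟩
  rcases hne with h | h | h
  · exact Or.inl h
  · exact Or.inr (Or.inl h)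
  · exact Or.inr (Or.inr (mul_ne_zero hk h))

/-- The norm form `⟨1, e, f, ef⟩` of a quaternion algebra is isotropic only if `⟨1, e, f⟩` is. -/
theorem of_quaternary {e f x y z w : K} (hw : w ≠ 0)
    (h : x ^ 2 + e * y ^ 2 + f * z ^ 2 + e * f * w ^ 2 = 0) : TernaryIsotropic K (-e) (-f) := by
  by_cases hN : z ^ 2 + e * w ^ 2 = 0
  · exact ⟨z, w, 0, Or.inr (Or.inl hw), by linear_combination hN⟩
  -- With N(u, v) = u² + e v², the hypothesis is N(x, y) = −f N(z, w). Multiplying by N(z, w) turns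
  -- the right side into −f times a square.
  · refine ⟨x * z - e * y * w, x * w + y * z, z ^ 2 + e * w ^ 2, Or.inr (Or.inr hN), ?_⟩
    linear_combination (z ^ 2 + e * w ^ 2) * h

end TernaryIsotropic

/-- A solution over `ℚ_[q]` can be rescaled to a primitive solution over `ℤ_[q]`. -/
theorem TernaryIsotropic.exists_primitive {q : ℕ} [Fact q.Prime] {a b : ℤ}
    (h : TernaryIsotropic ℚ_[q] a b) :
    ∃ x y z : ℤ_[q], (IsUnit x ∨ IsUnit y ∨ IsUnit z) ∧ x ^ 2 = a * y ^ 2 + b * z ^ 2 := by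
  obtain ⟨x, y, z, hne, h⟩ := h
  obtain ⟨c, hc, hx, hy, hz, hcc⟩ : ∃ c : ℚ_[q], c ≠ 0 ∧ ‖x‖ ≤ ‖c‖ ∧ ‖y‖ ≤ ‖c‖ ∧ ‖z‖ ≤ ‖c‖ ∧
      (c = x ∨ c = y ∨ c = z) := by
    clear h
    rcases le_total ‖x‖ ‖y‖ with h1 | h1 <;> rcases le_total ‖y‖ ‖z‖ with h2 | h2 <;>
    rcases le_total ‖x‖ ‖z‖ with h3 | h3
    all_goals first
      | exact ⟨x, by rintro rfl; simp_all, le_rfl, by assumption, by assumption, by simp⟩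
      | exact ⟨y, by rintro rfl; simp_all, by assumption, le_rfl, by assumption, by simp⟩
      | exact ⟨z, by rintro rfl; simp_all, by assumption, by assumption, le_rfl, by simp⟩
      | exact ⟨z, by rintro rfl; simp_all, by linarith, by assumption, le_rfl, by simp⟩
      | exact ⟨x, by rintro rfl; simp_all, le_rfl, by assumption, by linarith, by simp⟩
  have hc' : 0 < ‖c‖ := norm_pos_iff.2 hc
  have key : ∀ u : ℚ_[q], ‖u‖ ≤ ‖c‖ → ∃ u' : ℤ_[q], (u' : ℚ_[q]) = u / c := fun u hu =>
    ⟨⟨u / c, by rw [norm_div]; exact div_le_one_of_le₀ hu hc'.le⟩, rfl⟩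
  have hunit : ∀ u' : ℤ_[q], (u' : ℚ_[q]) = c / c → IsUnit u' := fun u' hu' => by
    rw [PadicInt.isUnit_iff, ← PadicInt.padic_norm_e_of_padicInt, hu', div_self hc, norm_one]
  obtain ⟨x', hx'⟩ := key x hx
  obtain ⟨y', hy'⟩ := key y hy
  obtain ⟨z', hz'⟩ := key z hz
  refine ⟨x', y', z', ?_, ?_⟩
  · rcases hcc with rfl | rfl | rfl
    · exact Or.inl (hunit _ hx')
    · exact Or.inr (Or.inl (hunit _ hy'))
    · exact Or.inr (Or.inr (hunit _ hz'))
  · apply PadicInt.ext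
    push_cast
    rw [hx', hy', hz', div_pow, h]
    ring

theorem not_ternaryIsotropic_neg_one_neg_one : ¬ TernaryIsotropic ℚ_[2] (-1) (-1) := by
  intro h
  have h' : TernaryIsotropic ℚ_[2] ((-1 : ℤ) : ℚ_[2]) ((-1 : ℤ) : ℚ_[2]) := by simpa using h
  obtain ⟨x, y, z, hu, h⟩ := h'.exists_primitive
  have h4 := congrArg (PadicInt.toZModPow (p := 2) 2) h
  simp only [map_pow, map_add, map_mul, map_intCast] at h4
  have hu' : IsUnit (PadicInt.toZModPow (p := 2) 2 x) ∨ IsUnit (PadicInt.toZModPow (p := 2) 2 y) ∨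
      IsUnit (PadicInt.toZModPow (p := 2) 2 z) := by
    rcases hu with hu | hu | hu
    · exact Or.inl (hu.map _)
    · exact Or.inr (Or.inl (hu.map _))
    · exact Or.inr (Or.inr (hu.map _))
  revert h4 hu'
  generalize PadicInt.toZModPow (p := 2) 2 x = x
  generalize PadicInt.toZModPow (p := 2) 2 y = y
  generalize PadicInt.toZModPow (p := 2) 2 z = z
  revert x y z
  change ∀ x y z : ZMod 4, _
  decide

/-- Reduce a primitive solution modulo q. If q ∣ y, then q ∣ x and z is a unit, which forces q² ∣ b.
Otherwise x / y is a square root of a. -/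
theorem TernaryIsotropic.exists_dvd_sq_sub {q : ℕ} [hq : Fact q.Prime] {a b : ℤ}
    (h : TernaryIsotropic ℚ_[q] a b) (hb : (q : ℤ) ∣ b) (hb2 : ¬ (q : ℤ) ^ 2 ∣ b) :
    ∃ t : ℤ, (q : ℤ) ∣ t ^ 2 - a := by
  obtain ⟨x, y, z, hu, h⟩ := h.exists_primitive
  have hmod := congrArg (PadicInt.toZMod (p := q)) h
  have hb0 : ((b : ℤ) : ZMod q) = 0 := (ZMod.intCast_zmod_eq_zero_iff_dvd _ _).2 hb
  simp only [map_pow, map_add, map_mul, map_intCast, hb0, zero_mul, add_zero] at hmod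
  by_cases hy : PadicInt.toZMod y = 0
  · exfalso
    have hx : PadicInt.toZMod x = 0 := by
      rw [hy] at hmod; simpa using hmod
    have hdvd : ∀ u : ℤ_[q], PadicInt.toZMod u = 0 → (q : ℤ_[q]) ∣ u := fun u hu => by
      have : u ∈ RingHom.ker (PadicInt.toZMod (p := q)) := hu
      rw [PadicInt.ker_toZMod, PadicInt.maximalIdeal_eq_span_p, Ideal.mem_span_singleton] at this
      exact this
    obtain ⟨x', rfl⟩ := hdvd x hx
    obtain ⟨y', rfl⟩ := hdvd y hy
    have hqn : ¬ IsUnit (q : ℤ_[q]) := PadicInt.prime_p.not_isUnit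
    have hz : IsUnit z := by
      rcases hu with h1 | h1 | h1
      · exact absurd (isUnit_of_mul_isUnit_left h1) hqn
      · exact absurd (isUnit_of_mul_isUnit_left h1) hqn
      · exact h1
    obtain ⟨c, rfl⟩ := hb
    have hq0 : (q : ℤ_[q]) ≠ 0 := PadicInt.prime_p.ne_zero
    have h2 : (c : ℤ_[q]) * z ^ 2 = q * (x' ^ 2 - a * y' ^ 2) := by
      apply mul_left_cancel₀ hq0
      push_cast at h
      linear_combination -h
    have h3 : (q : ℤ_[q]) ∣ (c : ℤ_[q]) := by
      have : (q : ℤ_[q]) ∣ (c : ℤ_[q]) * z ^ 2 := ⟨_, h2⟩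
      exact (hz.pow 2).dvd_mul_right.1 this
    have h4 : (q : ℤ) ∣ c := by
      have := (PadicInt.norm_int_lt_one_iff_dvd (p := q) c).1
        ((PadicInt.norm_lt_one_iff_dvd _).2 h3)
      exact this
    exact hb2 (by rw [pow_two]; exact mul_dvd_mul_left _ h4)
  · obtain ⟨t, ht⟩ := ZMod.intCast_surjective (PadicInt.toZMod x / PadicInt.toZMod y)
    refine ⟨t, ?_⟩
    rw [← ZMod.intCast_zmod_eq_zero_iff_dvd]
    push_cast
    rw [ht, div_pow, hmod]
    field_simp
    ring

theorem exists_dvd_sq_sub_of_squarefree (a : ℤ) {n : ℕ} (hn : Squarefree n)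
    (h : ∀ p : ℕ, p.Prime → p ∣ n → ∃ t : ℤ, (p : ℤ) ∣ t ^ 2 - a) :
    ∃ t : ℤ, (n : ℤ) ∣ t ^ 2 - a := by
  induction n using Nat.recOnMul with
  | zero => exact absurd hn not_squarefree_zero
  | one => exact ⟨0, by simp⟩
  | prime p hp => exact h p hp dvd_rfl
  | mul k l ihk ihl =>
    have hcop : Nat.Coprime k l := (Nat.squarefree_mul_iff.1 hn).1
    obtain ⟨t, ht⟩ := ihk (Nat.squarefree_mul_iff.1 hn).2.1
      (fun p hp hpk => h p hp (hpk.mul_right _))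
    obtain ⟨u, hu⟩ := ihl (Nat.squarefree_mul_iff.1 hn).2.2
      (fun p hp hpk => h p hp (hpk.mul_left _))
    have hcop' : IsCoprime (k : ℤ) l := Nat.isCoprime_iff_coprime.2 hcop
    obtain ⟨c, d, hcd⟩ := id hcop'
    obtain ⟨t', ht'⟩ := ht
    obtain ⟨u', hu'⟩ := hu
    refine ⟨t * (d * l) + u * (c * k), ?_⟩
    push_cast
    apply hcop'.mul_dvd
    · have : (t * (d * l) + u * (c * k)) = t + k * (c * (u - t)) := by
        linear_combination t * hcd
      rw [this]
      exact ⟨t' + 2 * t * (c * (u - t)) + k * (c * (u - t)) ^ 2, by linear_combination ht'⟩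
    · have : (t * (d * l) + u * (c * k)) = u + l * (d * (t - u)) := by
        linear_combination u * hcd
      rw [this]
      exact ⟨u' + 2 * u * (d * (t - u)) + l * (d * (t - u)) ^ 2, by linear_combination hu'⟩

/-- Legendre's descent in the definite case: `x² + e y² + f z² = 0` cannot be
solvable in every `ℚ_[q]`. -/
theorem not_forall_ternaryIsotropic_of_squarefree {e f : ℕ} (he : Squarefree e)
    (hf : Squarefree f)
    (h : ∀ (q : ℕ) [Fact q.Prime], TernaryIsotropic ℚ_[q] (-(e : ℚ_[q])) (-(f : ℚ_[q]))) :
    False := by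
  induction hN : e + f using Nat.strong_induction_on generalizing e f with
  | _ N ih =>
  wlog hef : e ≤ f generalizing e f
  · exact this hf he (fun q _ => (h q).symm) (by omega) (by omega)
  have he0 : 0 < e := Nat.pos_of_ne_zero he.ne_zero
  rcases Nat.lt_or_ge f 2 with hf2 | hf2
  · obtain rfl : e = 1 := by omega
    obtain rfl : f = 1 := by omega
    exact not_ternaryIsotropic_neg_one_neg_one (by simpa using h 2)
  obtain ⟨t₀, ht₀⟩ := exists_dvd_sq_sub_of_squarefree (-(e : ℤ)) hf (fun p hp hpf => by
    have : Fact p.Prime := ⟨hp⟩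
    have h1 : TernaryIsotropic ℚ_[p] ((-(e : ℤ) : ℤ) : ℚ_[p]) ((-(f : ℤ) : ℤ) : ℚ_[p]) := by
      simpa using h p
    refine h1.exists_dvd_sq_sub ?_ ?_
    · rw [dvd_neg]; exact_mod_cast hpf
    · rw [dvd_neg]
      intro h2
      have h3 : p ^ 2 ∣ f := by exact_mod_cast h2
      rw [pow_two] at h3
      exact hp.one_lt.ne' (Nat.isUnit_iff.1 (hf p h3)))
  -- The residue of least absolute value makes the cofactor c in t² + e = f c smaller than f, so the
  -- sum e + f drops.
  obtain ⟨t, ht, htl, htu⟩ : ∃ t : ℤ, (f : ℤ) ∣ t ^ 2 + e ∧ -(f : ℤ) ≤ 2 * t ∧ 2 * t ≤ f := by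
    refine ⟨t₀.bmod f, ?_, ?_, ?_⟩
    · have h1 : (f : ℤ) ∣ t₀.bmod f - t₀ := Int.dvd_bmod_sub_self
      have h2 : (t₀.bmod f) ^ 2 + (e : ℤ) =
        (t₀ ^ 2 - -(e : ℤ)) + (t₀.bmod f - t₀) * (t₀.bmod f + t₀) := by ring
      rw [h2]
      exact dvd_add ht₀ (h1.mul_right _)
    · have := Int.le_bmod (x := t₀) (m := f) (by omega)
      omega
    · have := Int.bmod_le (x := t₀) (m := f) (by omega)
      omega
  obtain ⟨c, hc⟩ := ht
  have hf0 : (0 : ℤ) < f := by omega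
  have hc0 : 0 < c := by
    by_contra hcn
    have : (f : ℤ) * c ≤ 0 := mul_nonpos_of_nonneg_of_nonpos hf0.le (by omega)
    nlinarith [sq_nonneg t]
  have hcf : c < f := by
    by_contra hcn
    have h1 : (f : ℤ) * f ≤ f * c := mul_le_mul_of_nonneg_left (by omega) hf0.le
    have h2 : (2 * t) ^ 2 ≤ (f : ℤ) ^ 2 := sq_le_sq' htl htu
    have h3 : (2 : ℤ) ≤ f := by omega
    have h4 : (e : ℤ) ≤ f := by omega
    nlinarith
  lift c to ℕ using hc0.le
  obtain ⟨c', k, hck, hc'⟩ := Nat.sq_mul_squarefree c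
  have hk0 : k ≠ 0 := by rintro rfl; simp at hck; omega
  have hc'c : c' ≤ c := by
    rw [← hck]; exact Nat.le_mul_of_pos_left _ (by positivity)
  refine ih (e + c') (by omega) he hc' (fun q _ => ?_) rfl
  have h1 : TernaryIsotropic ℚ_[q] (-(e : ℚ_[q])) (-(c : ℚ_[q])) := by
    refine (h q).of_norm_eq_mul (t := (t : ℚ_[q])) ?_ ?_
    · rw [neg_ne_zero]; exact_mod_cast (by omega : f ≠ 0)
    · have : ((t ^ 2 + e : ℤ) : ℚ_[q]) = ((f * c : ℤ) : ℚ_[q]) := by rw [hc]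
      push_cast at this
      linear_combination this
  refine TernaryIsotropic.of_mul_sq (k := (k : ℚ_[q])) ?_ (by exact_mod_cast hk0)
  rw [← hck] at h1
  push_cast at h1
  simpa [mul_neg] using h1

theorem exists_prime_not_ternaryIsotropic {e f : ℕ} (he : e ≠ 0) (hf : f ≠ 0) :
    ∃ (q : ℕ) (_ : Fact q.Prime), ¬ TernaryIsotropic ℚ_[q] (-(e : ℚ_[q])) (-(f : ℚ_[q])) := by
  by_contra! hcon
  obtain ⟨e', k, hek, he'⟩ := Nat.sq_mul_squarefree e
  obtain ⟨f', l, hfl, hf'⟩ := Nat.sq_mul_squarefree f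
  refine not_forall_ternaryIsotropic_of_squarefree he' hf' fun q hq => ?_
  have hk0 : (k : ℚ_[q]) ≠ 0 := by
    rintro h; have : k = 0 := by exact_mod_cast h
    subst this; simp at hek; omega
  have hl0 : (l : ℚ_[q]) ≠ 0 := by
    rintro h; have : l = 0 := by exact_mod_cast h
    subst this; simp at hfl; omega
  have h := hcon q hq
  rw [← hek, ← hfl] at h
  refine TernaryIsotropic.of_mul_sq (k := (l : ℚ_[q])) ?_ hl0
  refine (TernaryIsotropic.of_mul_sq (k := (k : ℚ_[q])) (b := -(e' : ℚ_[q])) ?_ hk0).symm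
  have := h.symm
  push_cast at this
  simpa [mul_neg] using this

/-! ### Squares in ℤ_q and isotropy at good primes -/

/-- Hensel's lemma for square roots. -/
theorem PadicInt.isSquare_of_norm_lt {q : ℕ} [Fact q.Prime] {u a : ℤ_[q]}
    (h : ‖a ^ 2 - u‖ < ‖2 * a‖ ^ 2) : IsSquare u := by
  obtain ⟨z, hz, -⟩ := hensels_lemma (p := q) (R := ℤ_[q])
    (F := (Polynomial.X ^ 2 - Polynomial.C u)) (a := a) (by
      simpa [Polynomial.derivative_X_pow, Polynomial.aeval_def, one_add_one_eq_two] using h)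
  refine ⟨z, ?_⟩
  simp at hz
  linear_combination -hz

theorem PadicInt.norm_two_of_ne_two {q : ℕ} [hq : Fact q.Prime] (hq2 : q ≠ 2) :
    ‖(2 : ℤ_[q])‖ = 1 := by
  rw [← Nat.cast_two, PadicInt.norm_natCast_eq_one_iff]
  exact (Nat.coprime_primes hq.out Nat.prime_two).2 hq2

theorem PadicInt.isSquare_of_dvd_sq_sub {q : ℕ} [hq : Fact q.Prime] (hq2 : q ≠ 2) {u a : ℤ}
    (hu : ¬ (q : ℤ) ∣ u) (h : (q : ℤ) ∣ a ^ 2 - u) : IsSquare (u : ℤ_[q]) := by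
  have ha : ¬ (q : ℤ) ∣ a := fun ha => hu (by
    have : u = a ^ 2 - (a ^ 2 - u) := by ring
    rw [this]
    exact dvd_sub (dvd_pow ha two_ne_zero) h)
  apply PadicInt.isSquare_of_norm_lt (a := (a : ℤ_[q]))
  have h1 : ‖(a : ℤ_[q])‖ = 1 := by
    refine le_antisymm (PadicInt.norm_le_one _) (not_lt.1 fun hlt => ha ?_)
    exact (PadicInt.norm_int_lt_one_iff_dvd a).1 hlt
  rw [norm_mul, PadicInt.norm_two_of_ne_two hq2, h1]
  have := (PadicInt.norm_int_lt_one_iff_dvd (p := q) (a ^ 2 - u)).2 h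
  push_cast at this
  simpa using this

theorem PadicInt.isSquare_of_mod_eight {u : ℤ} (h : (8 : ℤ) ∣ u - 1) : IsSquare (u : ℤ_[2]) := by
  apply PadicInt.isSquare_of_norm_lt (a := 1)
  have h2 : ‖(2 : ℤ_[2])‖ = 2⁻¹ := by simpa using PadicInt.norm_p (p := 2)
  have h8 : ‖((u - 1 : ℤ) : ℤ_[2])‖ ≤ (2 : ℝ) ^ (-(3 : ℕ) : ℤ) := by
    have := (PadicInt.norm_int_le_pow_iff_dvd (p := 2) (k := u - 1) (n := 3)).2 (by simpa using h)
    simpa using this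
  have h9 : ((1 : ℤ_[2]) ^ 2 - u) = -((u - 1 : ℤ) : ℤ_[2]) := by push_cast; ring
  rw [h9, norm_neg, mul_one, h2]
  refine h8.trans_lt ?_
  norm_num

/-- By counting, e y² + 1 and −f z² share a value modulo q. Then −e y² − f z² is 1 modulo q, and
Hensel's lemma makes it a square. -/
theorem ternaryIsotropic_of_not_dvd {q : ℕ} [hq : Fact q.Prime] (hq2 : q ≠ 2) {e f : ℕ}
    (he : ¬ q ∣ e) (hf : ¬ q ∣ f) :
    TernaryIsotropic ℚ_[q] (-(e : ℚ_[q])) (-(f : ℚ_[q])) := by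
  have he' : (e : ZMod q) ≠ 0 := by rwa [Ne, ZMod.natCast_eq_zero_iff]
  have hf' : (f : ZMod q) ≠ 0 := by rwa [Ne, ZMod.natCast_eq_zero_iff]
  obtain ⟨y, z, hyz⟩ := FiniteField.exists_root_sum_quadratic (R := ZMod q)
    (f := Polynomial.C (e : ZMod q) * Polynomial.X ^ 2 + Polynomial.C 0 * Polynomial.X
      + Polynomial.C 1)
    (g := Polynomial.C (f : ZMod q) * Polynomial.X ^ 2 + Polynomial.C 0 * Polynomial.X
      + Polynomial.C 0)
    (Polynomial.degree_quadratic he') (Polynomial.degree_quadratic hf')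
    (by rw [ZMod.card]; exact (hq.out.eq_two_or_odd).resolve_left hq2)
  simp at hyz
  obtain ⟨y, rfl⟩ := ZMod.intCast_surjective y
  obtain ⟨z, rfl⟩ := ZMod.intCast_surjective z
  have hdvd : (q : ℤ) ∣ 1 ^ 2 - (-(e * y ^ 2) - f * z ^ 2) := by
    rw [← ZMod.intCast_zmod_eq_zero_iff_dvd]
    push_cast
    linear_combination hyz
  have hnd : ¬ (q : ℤ) ∣ (-(e * y ^ 2) - f * z ^ 2) := fun h => by
    have := dvd_add hdvd h
    rw [sub_add_cancel, one_pow] at this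
    exact hq.out.one_lt.ne' (Nat.isUnit_iff.1 (Int.ofNat_isUnit.1 (isUnit_of_dvd_one this)))
  obtain ⟨x, hx⟩ := PadicInt.isSquare_of_dvd_sq_sub hq2 hnd hdvd
  have hx0 : x ≠ 0 := by
    rintro rfl
    rw [mul_zero, Int.cast_eq_zero] at hx
    exact hnd (hx ▸ dvd_zero _)
  refine ⟨x, y, z, Or.inl (by simpa using hx0), ?_⟩
  have := congrArg (fun w : ℤ_[q] => (w : ℚ_[q])) hx
  push_cast at this
  linear_combination -this

/-! ### Least non-residues and square classes -/

theorem exists_not_isSquare {p : ℕ} [hp : Fact p.Prime] (hp2 : p ≠ 2) :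
    {n : ℕ | ¬ IsSquare (n : ZMod p)}.Nonempty := by
  obtain ⟨a, ha⟩ := FiniteField.exists_nonsquare (F := ZMod p) (by
    rwa [ZMod.ringChar_zmod_n])
  obtain ⟨n, rfl⟩ := ZMod.natCast_zmod_surjective a
  exact ⟨n, ha⟩

theorem not_isSquare_leastNonresidue {p : ℕ} [hp : Fact p.Prime] (hp2 : p ≠ 2) :
    ¬ IsSquare (leastNonresidue p : ZMod p) := by
  rw [leastNonresidue, if_neg hp2]
  exact Nat.sInf_mem (exists_not_isSquare hp2)

theorem isSquare_of_lt_leastNonresidue {p n : ℕ} (hp2 : p ≠ 2) (h : n < leastNonresidue p) :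
    IsSquare (n : ZMod p) := by
  rw [leastNonresidue, if_neg hp2] at h
  simpa using Nat.notMem_of_lt_sInf h

theorem two_le_leastNonresidue {p : ℕ} [hp : Fact p.Prime] : 2 ≤ leastNonresidue p := by
  by_cases hp2 : p = 2
  · simp [leastNonresidue, hp2]
  · by_contra hlt
    apply not_isSquare_leastNonresidue hp2
    have : leastNonresidue p = 0 ∨ leastNonresidue p = 1 := by omega
    rcases this with h | h <;> rw [h] <;> simp

/-- For the least k with n k > p, the number n k − p lies in (0, n), so it is a square modulo p. If
k < n, then k is a square too, and hence so is n. This bound later yields C ≤ 7m. -/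
theorem leastNonresidue_mul_sub_one_lt {p : ℕ} [hp : Fact p.Prime] (hp2 : p ≠ 2) :
    leastNonresidue p * (leastNonresidue p - 1) < p := by
  set n := leastNonresidue p with hn
  have hn2 : 2 ≤ n := two_le_leastNonresidue
  have hns := not_isSquare_leastNonresidue hp2
  rw [← hn] at hns
  by_contra! hle
  set k := p / n + 1 with hk
  have hlt : n * k < p + n := by
    have := Nat.mul_div_le p n
    have hne : n * (p / n) ≠ p := fun h => by
      rcases (Nat.dvd_prime hp.out).1 ⟨_, h.symm⟩ with h1 | h1
      · omega
      · rw [h1] at hns; simp at hns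
    rw [hk, mul_add, mul_one]; omega
  have hgt : p < n * k := by
    rw [hk]; exact Nat.lt_mul_div_succ p (by omega)
  have hr : IsSquare ((n * k - p : ℕ) : ZMod p) :=
    isSquare_of_lt_leastNonresidue hp2 (by omega)
  rw [Nat.cast_sub hgt.le, ZMod.natCast_self, sub_zero] at hr
  have hkn : k < n := by
    by_contra! hnk
    have h1 : n - 1 ≤ p / n := by
      rw [hk] at hnk
      exact Nat.sub_le_of_le_add hnk
    have h2 : (n - 1) * n ≤ p := (Nat.le_div_iff_mul_le (by omega)).1 h1
    have h3 : n * (n - 1) = p := le_antisymm (by rwa [mul_comm]) hle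
    rcases (Nat.dvd_prime hp.out).1 ⟨_, h3.symm⟩ with h4 | h4
    · omega
    · rw [h4] at hns; simp at hns
  have hks : IsSquare (k : ZMod p) := isSquare_of_lt_leastNonresidue hp2 hkn
  have hk0 : (k : ZMod p) ≠ 0 := by
    rw [Ne, ZMod.natCast_eq_zero_iff]
    intro hd
    have := Nat.le_of_dvd (Nat.succ_pos (p / n)) hd
    have h1 : k ≤ p / 2 + 1 := Nat.succ_le_succ <| Nat.div_le_div_left hn2 two_pos
    have h2 := hp.out.two_le
    omega
  apply hns
  have : (n : ZMod p) = ((n * k : ℕ) : ZMod p) * (k : ZMod p)⁻¹ := by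
    push_cast; field_simp
  rw [this]
  exact hr.mul hks.inv

theorem PadicInt.exists_isSquare_unit_mul {q : ℕ} [hq : Fact q.Prime] {u : ℤ}
    (hu : ¬ (q : ℤ) ∣ u) :
    ∃ d : ℕ, 1 ≤ d ∧ d ≤ leastNonresidue q ∧ IsSquare ((d * u : ℤ) : ℤ_[q]) := by
  by_cases hq2 : q = 2
  · subst hq2
    have h1 : ¬ (2 : ℤ) ∣ u := hu
    have h0 : (u % 8 = 1 ∨ u % 8 = 3 ∨ u % 8 = 5 ∨ u % 8 = 7) := by omega
    -- For odd u, u · (u mod 8) ≡ u² ≡ 1 modulo 8. The residues go up to 7, which is `γ_2`.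
    refine ⟨(u % 8).toNat, by omega, by simp only [leastNonresidue, if_true]; omega, ?_⟩
    apply PadicInt.isSquare_of_mod_eight
    rw [Int.toNat_of_nonneg (by omega)]
    have h2 : u = 8 * (u / 8) + u % 8 := (Int.mul_ediv_add_emod u 8).symm
    generalize u / 8 = v at h2
    generalize u % 8 = w at h2 h0
    subst h2
    rcases h0 with rfl | rfl | rfl | rfl <;> omega
  · by_cases hs : IsSquare (u : ZMod q)
    · refine ⟨1, le_rfl, one_le_two.trans two_le_leastNonresidue, ?_⟩
      obtain ⟨a, ha⟩ := hs
      obtain ⟨a, rfl⟩ := ZMod.intCast_surjective a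
      refine PadicInt.isSquare_of_dvd_sq_sub (a := a) hq2 (by simpa using hu) ?_
      rw [← ZMod.intCast_zmod_eq_zero_iff_dvd]
      push_cast
      linear_combination -ha
    · have hn := not_isSquare_leastNonresidue hq2
      refine ⟨leastNonresidue q, one_le_two.trans two_le_leastNonresidue, le_rfl, ?_⟩
      have hm : IsSquare ((leastNonresidue q : ZMod q) * (u : ZMod q)) := by
        have h0 : ((leastNonresidue q : ZMod q) * (u : ZMod q)) ≠ 0 := by
          refine mul_ne_zero (fun h => hn ?_) (fun h => hs ?_) <;> rw [h] <;> simp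
        rw [← quadraticChar_one_iff_isSquare h0, map_mul,
          quadraticChar_neg_one_iff_not_isSquare.2 hn, quadraticChar_neg_one_iff_not_isSquare.2 hs]
        norm_num
      obtain ⟨a, ha⟩ := hm
      obtain ⟨a, rfl⟩ := ZMod.intCast_surjective a
      refine PadicInt.isSquare_of_dvd_sq_sub (a := a) hq2 ?_ ?_
      · intro h
        rcases (Nat.prime_iff_prime_int.1 hq.out).dvd_or_dvd h with h | h
        · rw [← ZMod.intCast_zmod_eq_zero_iff_dvd] at h
          apply hn
          push_cast at h
          rw [h]; simp
        · exact hu h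
      · rw [← ZMod.intCast_zmod_eq_zero_iff_dvd]
        push_cast
        linear_combination -ha

/-- Each square class of `ℚ_[q]` contains a positive integer that is at most `q γ_q`. -/
theorem Padic.exists_isSquare_mul {q : ℕ} [hq : Fact q.Prime] {n : ℤ} (hn : n ≠ 0) :
    ∃ d : ℕ, 1 ≤ d ∧ d ≤ q * leastNonresidue q ∧ IsSquare ((d * n : ℤ) : ℚ_[q]) := by
  have hfin : FiniteMultiplicity (q : ℤ) n :=
    Int.finiteMultiplicity_iff.2 ⟨by simpa using hq.out.one_lt.ne', hn⟩
  obtain ⟨u, hnu, hu⟩ := hfin.exists_eq_pow_mul_and_not_dvd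
  generalize multiplicity (q : ℤ) n = k at hnu
  obtain ⟨d, hd1, hd2, x, hx⟩ := PadicInt.exists_isSquare_unit_mul hu
  have hx' := congrArg (fun w : ℤ_[q] => (w : ℚ_[q])) hx
  push_cast at hx'
  rcases Nat.even_or_odd' k with ⟨j, rfl | rfl⟩
  · refine ⟨d, hd1, hd2.trans (Nat.le_mul_of_pos_left _ hq.out.pos), q ^ j * x, ?_⟩
    rw [hnu]
    push_cast
    linear_combination (q : ℚ_[q]) ^ (2 * j) * hx'
  · refine ⟨q * d, Nat.mul_pos hq.out.pos hd1, Nat.mul_le_mul_left _ hd2, q ^ (j + 1) * x, ?_⟩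
    rw [hnu]
    push_cast
    linear_combination (q : ℚ_[q]) ^ (2 * j + 2) * hx'

/-! ### Small integers missed by binary and ternary forms -/

/-- A positive definite ternary space `⟨1, e, eg⟩` over `ℚ` fails to represent a small integer. -/
theorem exists_not_eq_ternary {e g : ℕ} (he : e ≠ 0) (hg : g ≠ 0) :
    ∃ q d : ℕ, q.Prime ∧ (q = 2 ∨ q ∣ e ∨ q ∣ g) ∧ 1 ≤ d ∧ d ≤ q * leastNonresidue q ∧
      ∀ x y z : ℚ, (d : ℚ) ≠ x ^ 2 + e * y ^ 2 + e * g * z ^ 2 := by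
  obtain ⟨q, hq, hani⟩ := exists_prime_not_ternaryIsotropic he (Nat.mul_ne_zero he hg)
  -- Up to squares the discriminant of ⟨1, e, eg⟩ is g, and an anisotropic ternary space over ℚ_q
  -- does not represent minus its discriminant.
  obtain ⟨d, hd1, hd2, r, hr⟩ := Padic.exists_isSquare_mul (q := q) (n := -(g : ℤ))
    (by simpa using hg)
  refine ⟨q, d, hq.out, ?_, hd1, hd2, fun x y z hxyz => hani ?_⟩
  · by_contra! hcon
    refine hani (ternaryIsotropic_of_not_dvd hcon.1 hcon.2.1 fun h => ?_)
    rcases (Nat.Prime.dvd_mul hq.out).1 h with h | h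
    · exact hcon.2.1 h
    · exact hcon.2.2 h
  · have hxyz' := congrArg (fun w : ℚ => (w : ℚ_[q])) hxyz
    push_cast at hxyz' hr
    have he' : (e : ℚ_[q]) ≠ 0 := by exact_mod_cast he
    have hg' : (g : ℚ_[q]) ≠ 0 := by exact_mod_cast hg
    have hd' : (d : ℚ_[q]) ≠ 0 := by exact_mod_cast (by omega : d ≠ 0)
    have hr0 : r ≠ 0 := by
      rintro rfl
      rw [mul_zero] at hr
      exact mul_ne_zero hd' (neg_ne_zero.2 hg') hr
    push_cast
    refine TernaryIsotropic.of_quaternary (x := (x : ℚ_[q])) (y := y) (z := z) (w := r / (g * e))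
      (div_ne_zero hr0 (mul_ne_zero hg' he')) ?_
    rw [← sub_eq_zero] at hxyz'
    field_simp
    linear_combination (-(g : ℚ_[q])) * hxyz' - hr

/-- A positive definite binary space `⟨1, e⟩` over `ℚ` fails to represent a small integer. -/
theorem exists_not_eq_binary {m e : ℕ} (hm : 0 < m) (he0 : e ≠ 0) (he : e ≤ 2 * m ^ 2) :
    ∃ p c : ℕ, p.Prime ∧ p ≤ 2 * m ^ 2 ∧ 2 ≤ c ∧ c ≤ leastNonresidue p ∧ c ≤ 7 * m ∧
      ∀ x y : ℚ, (c : ℚ) ≠ x ^ 2 + e * y ^ 2 := by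
  have hm1 : 1 ≤ m ^ 2 := Nat.one_le_pow _ _ hm
  obtain ⟨r, k, hkr, hr⟩ := Nat.sq_mul_squarefree e
  have hk0 : k ≠ 0 := by rintro rfl; simp at hkr; omega
  have hre : r ≤ e := by rw [← hkr]; exact Nat.le_mul_of_pos_left _ (by positivity)
  have key : ∀ (q : ℕ) [Fact q.Prime] (c : ℕ) (x y : ℚ), (c : ℚ) = x ^ 2 + e * y ^ 2 →
      TernaryIsotropic ℚ_[q] ((-(r : ℤ) : ℤ) : ℚ_[q]) ((c : ℤ) : ℚ_[q]) := by
    intro q _ c x y h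
    refine ⟨(x : ℚ_[q]), k * y, 1, by simp, ?_⟩
    have h' := congrArg (fun w : ℚ => (w : ℚ_[q])) h
    rw [← hkr] at h'
    push_cast at h' ⊢
    linear_combination -h'
  by_cases hodd : ∃ p : ℕ, p.Prime ∧ p ≠ 2 ∧ p ∣ r
  · obtain ⟨p, hp, hp2, hpr⟩ := hodd
    have : Fact p.Prime := ⟨hp⟩
    have hple : p ≤ 2 * m ^ 2 := (Nat.le_of_dvd (Nat.pos_of_ne_zero hr.ne_zero) hpr).trans
      (hre.trans he)
    have h2 : 2 ≤ leastNonresidue p := two_le_leastNonresidue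
    have hlt := leastNonresidue_mul_sub_one_lt hp2
    refine ⟨p, leastNonresidue p, hp, hple, h2, le_rfl, ?_, fun x y hxy => ?_⟩
    -- Otherwise 49 m² ≤ γ_p (γ_p − 1) < p ≤ 2 m².
    · by_contra! hlt7
      have h3 : 7 * m * (7 * m) ≤ leastNonresidue p * (leastNonresidue p - 1) :=
        Nat.mul_le_mul hlt7.le (by omega)
      nlinarith
    · obtain ⟨t, ht⟩ := (key p _ x y hxy).symm.exists_dvd_sq_sub
        (by rw [dvd_neg]; exact_mod_cast hpr) (by
          rw [dvd_neg]
          intro h2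
          have h3 : p ^ 2 ∣ r := by exact_mod_cast h2
          rw [pow_two] at h3
          exact hp.one_lt.ne' (Nat.isUnit_iff.1 (hr p h3)))
      rw [← ZMod.intCast_zmod_eq_zero_iff_dvd] at ht
      push_cast at ht
      exact not_isSquare_leastNonresidue hp2 ⟨t, by linear_combination -ht⟩
  · have hr12 : r = 1 ∨ r = 2 := by
      by_cases h1 : r = 1
      · exact Or.inl h1
      obtain ⟨p, hp, hpr⟩ := Nat.exists_prime_and_dvd h1
      have hp2 : p = 2 := by by_contra h; exact hodd ⟨p, hp, h, hpr⟩
      subst hp2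
      obtain ⟨l, rfl⟩ := hpr
      by_cases hl : l = 1
      · exact Or.inr (by rw [hl])
      obtain ⟨p, hp, hpl⟩ := Nat.exists_prime_and_dvd hl
      have hp2 : p = 2 := by by_contra h; exact hodd ⟨p, hp, h, hpl.mul_left _⟩
      subst hp2
      have := hr 2 (mul_dvd_mul_left 2 hpl)
      simp at this
    -- Now e is a square or twice a square. The integers 3 and 5 are excluded at the primes 3 and 5,
    -- where −1 and −2 are non-residues. The prime returned is 2 because γ_2 = 7 bounds both.
    rcases hr12 with rfl | rfl
    · refine ⟨2, 3, Nat.prime_two, by omega, by norm_num, by simp [leastNonresidue], by omega,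
        fun x y hxy => ?_⟩
      have aux : ∀ s : ZMod 3, s ^ 2 - -1 ≠ 0 := by decide
      have : Fact (Nat.Prime 3) := ⟨Nat.prime_three⟩
      obtain ⟨t, ht⟩ := (key 3 3 x y hxy).exists_dvd_sq_sub (by simp) (by norm_num)
      rw [← ZMod.intCast_zmod_eq_zero_iff_dvd] at ht
      push_cast at ht
      exact aux t ht
    · refine ⟨2, 5, Nat.prime_two, by omega, by norm_num, by simp [leastNonresidue], by omega,
        fun x y hxy => ?_⟩
      have aux : ∀ s : ZMod 5, s ^ 2 - -2 ≠ 0 := by decide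
      have : Fact (Nat.Prime 5) := ⟨Nat.prime_five⟩
      obtain ⟨t, ht⟩ := (key 5 5 x y hxy).exists_dvd_sq_sub (by simp) (by norm_num)
      rw [← ZMod.intCast_zmod_eq_zero_iff_dvd] at ht
      push_cast at ht
      exact aux t ht

/-! ### Singular Gram matrices as representations -/

/-- Sylvester's determinant identity with pivot `Y 0 0`. -/
theorem Matrix.IsSymm.mul_det_fin_three {R : Type*} [CommRing R] {Y : Matrix (Fin 3) (Fin 3) R}
    (hY : Y.IsSymm) :
    Y 0 0 * Y.det = (Y 0 0 * Y 1 1 - Y 0 1 ^ 2) * (Y 0 0 * Y 2 2 - Y 0 2 ^ 2)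
      - (Y 0 0 * Y 1 2 - Y 0 1 * Y 0 2) ^ 2 := by
  rw [Matrix.det_fin_three, hY.apply 0 1, hY.apply 0 2, hY.apply 1 2]
  ring

/-- Sylvester's identity with the leading 2 × 2 minor as pivot. -/
theorem Matrix.IsSymm.mul_det_fin_four {R : Type*} [CommRing R] {Y : Matrix (Fin 4) (Fin 4) R}
    (hY : Y.IsSymm) :
    (Y 0 0 * Y 1 1 - Y 0 1 ^ 2) * Y.det =
      (Y.submatrix ![0, 1, 2] ![0, 1, 2]).det * (Y.submatrix ![0, 1, 3] ![0, 1, 3]).det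
        - (Y.submatrix ![0, 1, 2] ![0, 1, 3]).det ^ 2 := by
  rw [Matrix.det_succ_row_zero, Fin.sum_univ_four]
  simp only [Matrix.det_fin_three, Matrix.submatrix_apply, Matrix.cons_val]
  simp [Fin.succAbove, Fin.lt_def]
  rw [hY.apply 0 1, hY.apply 0 2, hY.apply 0 3, hY.apply 1 2, hY.apply 1 3, hY.apply 2 3]
  ring

/-- If the determinant vanished, dividing `mul_det_fin_three` by e m², with e = 2m² − b², would
exhibit c as a value of ⟨1, e⟩. -/
theorem exists_prime_det_fin_three_ne_zero {m : ℕ} (hm : 0 < m) {b : ℤ} (hb : b ^ 2 < 2 * m ^ 2) :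
    ∃ p c : ℕ, p.Prime ∧ p ≤ 2 * m ^ 2 ∧ 2 ≤ c ∧ c ≤ leastNonresidue p ∧ c ≤ 7 * m ∧
      ∀ Y : Matrix (Fin 3) (Fin 3) ℤ, Y.IsSymm → Y 0 0 = m → Y 1 1 = 2 * m → Y 0 1 = b →
        Y 2 2 = c * m → Y.det ≠ 0 := by
  obtain ⟨e, he⟩ : ∃ e : ℕ, (e : ℤ) = 2 * m ^ 2 - b ^ 2 :=
    ⟨(2 * m ^ 2 - b ^ 2).toNat, Int.toNat_of_nonneg (by omega)⟩
  obtain ⟨p, c, hp, hpm, hc2, hcp, hcm, hc⟩ := exists_not_eq_binary hm (e := e) (by omega)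
    (by have := sq_nonneg b; zify; omega)
  refine ⟨p, c, hp, hpm, hc2, hcp, hcm, fun Y hY h00 h11 h01 h22 hdet => ?_⟩
  have h := hY.mul_det_fin_three
  rw [hdet, h00, h11, h01, h22, mul_zero, ← mul_assoc, mul_comm (m : ℤ) 2, mul_assoc, ← pow_two,
    ← he] at h
  have h' := congrArg (fun w : ℤ => (w : ℚ)) h
  push_cast at h'
  have hm' : (m : ℚ) ≠ 0 := by positivity
  have he' : (e : ℚ) ≠ 0 := by
    have : e ≠ 0 := by omega
    exact_mod_cast this
  apply hc (Y 0 2 / m) ((m * Y 1 2 - b * Y 0 2) / (m * e))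
  field_simp
  linear_combination -h'

/-- With e = 2m² − b², b = `T 0 1` and t = det T, a vanishing determinant would exhibit d as a value
of ⟨1, e, e m t⟩. The prime q is 2 or divides e, m or t. -/
theorem exists_prime_det_fin_four_ne_zero {m c : ℕ} (hm : 0 < m) (hc : 0 < c)
    {T : Matrix (Fin 3) (Fin 3) ℤ} (hT : T.IsSymm) (h00 : T 0 0 = m) (h11 : T 1 1 = 2 * m)
    (h22 : T 2 2 = c * m) (hb : T 0 1 ^ 2 < 2 * m ^ 2) (hdet : 0 < T.det) :
    ∃ q d : ℕ, q.Prime ∧ q ≤ 2 * c * m ^ 3 ∧ 1 ≤ d ∧ d ≤ q * leastNonresidue q ∧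
      ∀ Y : Matrix (Fin 4) (Fin 4) ℤ, Y.IsSymm → Y.submatrix ![0, 1, 2] ![0, 1, 2] = T →
        Y 3 3 = d * m → Y.det ≠ 0 := by
  obtain ⟨e, he⟩ : ∃ e : ℕ, (e : ℤ) = 2 * m ^ 2 - T 0 1 ^ 2 :=
    ⟨(2 * m ^ 2 - T 0 1 ^ 2).toNat, Int.toNat_of_nonneg (by omega)⟩
  obtain ⟨t, ht⟩ : ∃ t : ℕ, (t : ℤ) = T.det := ⟨T.det.toNat, Int.toNat_of_nonneg hdet.le⟩
  have he0 : 0 < e := by omega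
  have ht0 : 0 < t := by omega
  have hem : e ≤ 2 * m ^ 2 := by have := sq_nonneg (T 0 1); zify; omega
  -- A Hadamard-type bound: m t equals e (c m² − T₀₂²) minus a square, and e ≤ 2m².
  have htm : t ≤ 2 * c * m ^ 3 := by
    have h := hT.mul_det_fin_three
    rw [h00, h11, h22, ← ht, ← mul_assoc (m : ℤ) 2, mul_comm (m : ℤ) 2, mul_assoc 2, ← pow_two,
      ← he] at h
    have h1 : (e : ℤ) * (m * (c * m) - T 0 2 ^ 2) ≤ 2 * m ^ 2 * (m * (c * m)) := by
      have h3 : (e : ℤ) ≤ 2 * m ^ 2 := by exact_mod_cast hem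
      calc (e : ℤ) * (m * (c * m) - T 0 2 ^ 2) ≤ e * (m * (c * m)) := by
            apply mul_le_mul_of_nonneg_left _ (by positivity)
            linarith [sq_nonneg (T 0 2)]
        _ ≤ _ := mul_le_mul_of_nonneg_right h3 (by positivity)
    have h2 : (m : ℤ) * t ≤ m * (2 * c * m ^ 3) := by
      nlinarith [sq_nonneg (m * T 1 2 - T 0 1 * T 0 2)]
    exact_mod_cast le_of_mul_le_mul_left h2 (by exact_mod_cast hm)
  obtain ⟨q, d, hq, hqd, hd1, hd2, hd⟩ := exists_not_eq_ternary (e := e) (g := m * t)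
    (by omega) (by positivity)
  have hm3 : m ^ 2 ≤ m ^ 3 := Nat.pow_le_pow_right hm (by norm_num)
  have hm1 : m ≤ m ^ 3 := Nat.le_self_pow (by norm_num) m
  have hcm3 : m ^ 3 ≤ c * m ^ 3 := Nat.le_mul_of_pos_left _ hc
  refine ⟨q, d, hq, ?_, hd1, hd2, fun Y hY hYT h33 hYdet => ?_⟩
  · rw [Nat.mul_assoc] at htm ⊢
    rcases hqd with rfl | h | h
    · omega
    · have := Nat.le_of_dvd he0 h
      omega
    · rcases (Nat.Prime.dvd_mul hq).1 h with h | h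
      · have := Nat.le_of_dvd hm h
        omega
      · have := Nat.le_of_dvd ht0 h
        omega
  · have h := hY.mul_det_fin_four
    have e00 : Y 0 0 = m := by rw [← h00, ← hYT]; rfl
    have e01 : Y 0 1 = T 0 1 := by rw [← hYT]; rfl
    have e11 : Y 1 1 = 2 * m := by rw [← h11, ← hYT]; rfl
    have h3 := (hY.submatrix ![0, 1, 3]).mul_det_fin_three
    simp only [Matrix.submatrix_apply, Matrix.cons_val] at h3
    rw [hYdet, hYT, ← ht, mul_zero] at h
    rw [e00, e01, e11, h33] at h3
    generalize (Y.submatrix ![0, 1, 3] ![0, 1, 3]).det = M at h h3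
    generalize (Y.submatrix ![0, 1, 2] ![0, 1, 3]).det = κ at h
    have he2 : (m : ℤ) * (2 * m) - T 0 1 ^ 2 = e := by rw [he]; ring
    rw [he2] at h3
    have h' := congrArg (fun w : ℤ => (w : ℚ)) h
    have h3' := congrArg (fun w : ℤ => (w : ℚ)) h3
    push_cast at h' h3'
    have hm' : (m : ℚ) ≠ 0 := by positivity
    have he' : (e : ℚ) ≠ 0 := by positivity
    have ht' : (t : ℚ) ≠ 0 := by positivity
    apply hd (Y 0 3 / m) ((m * Y 1 3 - T 0 1 * Y 0 3) / (m * e)) (κ / (m * t * e))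
    push_cast
    field_simp
    linear_combination (-(t : ℚ)) * h3' - m * h'

/-! ### Positive definiteness from a nonzero integral determinant -/

open Matrix in
theorem Matrix.dotProduct_mulVec_eq_sum {ι R : Type*} [Fintype ι] [CommRing R] (A : Matrix ι ι R)
    (x : ι → R) : x ⬝ᵥ A *ᵥ x = ∑ i, ∑ j, A i j * (x i * x j) := by
  simp only [dotProduct, mulVec, Finset.mul_sum]
  exact Finset.sum_congr rfl fun i _ => Finset.sum_congr rfl fun j _ => by ring

theorem Matrix.IsHermitian.neg_le_eigenvalues {ι : Type*} [Fintype ι] [DecidableEq ι]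
    {Z : Matrix ι ι ℝ} (hZ : Z.IsHermitian) {μ : ℝ}
    (h : ∀ x : ι → ℝ, 0 ≤ ∑ i, ∑ j, Z i j * (x i * x j) + μ * ∑ i, x i ^ 2) (i : ι) :
    -μ ≤ hZ.eigenvalues i := by
  have h1 := hZ.eigenvalues_eq i
  have h2 := h (hZ.eigenvectorBasis i)
  have h3 : ∑ j, hZ.eigenvectorBasis i j ^ 2 = 1 := by
    have := hZ.eigenvectorBasis.orthonormal.1 i
    rw [EuclideanSpace.norm_eq, Real.sqrt_eq_one] at this
    simpa using this
  rw [h3, ← Matrix.dotProduct_mulVec_eq_sum, mul_one] at h2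
  rw [h1]
  simpa using neg_le_iff_add_nonneg.2 h2

/-- An eigenvalue in [−μ, 0] would bound |det| by μ times the product of the other two absolute
values, which AM–GM controls through the trace. -/
theorem Matrix.IsHermitian.posDef_fin_three {Z : Matrix (Fin 3) (Fin 3) ℝ} (hZ : Z.IsHermitian)
    {μ : ℝ} (hμ : ∀ i, -μ ≤ hZ.eigenvalues i)
    (hdet : μ * ((Z.trace + 5 * μ) / 2) ^ 2 < |Z.det|) : Z.PosDef := by
  have key : ∀ a b c : ℝ, -μ ≤ a → -μ ≤ b → -μ ≤ c → a + b + c = Z.trace → |a * b * c| = |Z.det| →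
      0 < a := by
    intro a b c ha hb hc htr hd
    by_contra! ha0
    have h1 : |a| ≤ μ := abs_le.2 ⟨ha, by linarith⟩
    have h2 : |b| ≤ b + 2 * μ := abs_le.2 ⟨by linarith, by linarith⟩
    have h3 : |c| ≤ c + 2 * μ := abs_le.2 ⟨by linarith, by linarith⟩
    have h4 : |b| * |c| ≤ ((Z.trace + 5 * μ) / 2) ^ 2 :=
      calc |b| * |c| ≤ (b + 2 * μ) * (c + 2 * μ) := by gcongr; linarith
        _ ≤ ((b + c + 4 * μ) / 2) ^ 2 := by nlinarith [sq_nonneg (b - c)]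
        _ ≤ _ := by apply pow_le_pow_left₀ <;> linarith
    rw [← hd, abs_mul, abs_mul, mul_assoc] at hdet
    have h5 : |a| * (|b| * |c|) ≤ μ * ((Z.trace + 5 * μ) / 2) ^ 2 := by gcongr; linarith
    linarith
  have htr := hZ.trace_eq_sum_eigenvalues
  have hd := congrArg abs hZ.det_eq_prod_eigenvalues
  simp only [Fin.sum_univ_three, Fin.prod_univ_three, RCLike.ofReal_real_eq_id, id] at htr hd
  refine hZ.posDef_iff_eigenvalues_pos.2 fun i => ?_
  match i with
  | 0 => exact key _ _ _ (hμ 0) (hμ 1) (hμ 2) htr.symm hd.symm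
  | 1 => exact key _ _ _ (hμ 1) (hμ 0) (hμ 2) (by rw [htr]; ring) (by rw [hd]; congr 1; ring)
  | 2 => exact key _ _ _ (hμ 2) (hμ 0) (hμ 1) (by rw [htr]; ring) (by rw [hd]; congr 1; ring)

/-- As in dimension three, but AM–GM is applied to two of the remaining eigenvalues and the third is
bounded directly by the trace. -/
theorem Matrix.IsHermitian.posDef_fin_four {Z : Matrix (Fin 4) (Fin 4) ℝ} (hZ : Z.IsHermitian)
    {μ : ℝ} (hμ : ∀ i, -μ ≤ hZ.eigenvalues i)
    (hdet : μ * (Z.trace + 7 * μ) ^ 3 / 4 < |Z.det|) : Z.PosDef := by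
  have key : ∀ a b c d : ℝ, -μ ≤ a → -μ ≤ b → -μ ≤ c → -μ ≤ d → a + b + c + d = Z.trace →
      |a * b * c * d| = |Z.det| → 0 < a := by
    intro a b c d ha hb hc hd htr hdt
    by_contra! ha0
    have h1 : |a| ≤ μ := abs_le.2 ⟨ha, by linarith⟩
    have h2 : |b| ≤ b + 2 * μ := abs_le.2 ⟨by linarith, by linarith⟩
    have h3 : |c| ≤ c + 2 * μ := abs_le.2 ⟨by linarith, by linarith⟩
    have h3' : |d| ≤ d + 2 * μ := abs_le.2 ⟨by linarith, by linarith⟩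
    have h4 : |b| * |c| ≤ ((Z.trace + 7 * μ) / 2) ^ 2 :=
      calc |b| * |c| ≤ (b + 2 * μ) * (c + 2 * μ) := by gcongr; linarith
        _ ≤ ((b + c + 4 * μ) / 2) ^ 2 := by nlinarith [sq_nonneg (b - c)]
        _ ≤ _ := by apply pow_le_pow_left₀ <;> linarith
    have h4' : |d| ≤ Z.trace + 7 * μ := by linarith
    rw [← hdt, abs_mul, abs_mul, abs_mul, mul_assoc |a|] at hdet
    have h5 : |a| * (|b| * |c|) * |d| ≤
        μ * ((Z.trace + 7 * μ) / 2) ^ 2 * (Z.trace + 7 * μ) := by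
      have h6 : 0 ≤ μ := (abs_nonneg a).trans h1
      gcongr
    nlinarith
  have htr := hZ.trace_eq_sum_eigenvalues
  have hd := congrArg abs hZ.det_eq_prod_eigenvalues
  simp only [Fin.sum_univ_four, Fin.prod_univ_four, RCLike.ofReal_real_eq_id, id] at htr hd
  refine hZ.posDef_iff_eigenvalues_pos.2 fun i => ?_
  match i with
  | 0 => exact key _ _ _ _ (hμ 0) (hμ 1) (hμ 2) (hμ 3) htr.symm hd.symm
  | 1 => exact key _ _ _ _ (hμ 1) (hμ 0) (hμ 2) (hμ 3) (by rw [htr]; ring) (by rw [hd]; congr 1; ring)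
  | 2 => exact key _ _ _ _ (hμ 2) (hμ 0) (hμ 1) (hμ 3) (by rw [htr]; ring) (by rw [hd]; congr 1; ring)
  | 3 => exact key _ _ _ _ (hμ 3) (hμ 0) (hμ 1) (hμ 2) (by rw [htr]; ring) (by rw [hd]; congr 1; ring)

section Scaling

variable {ι : Type*} [Fintype ι]

theorem Matrix.posDef_of_diagonal_mul_mul_diagonal [DecidableEq ι] {Y : Matrix ι ι ℝ} {d : ι → ℝ}
    (hd : ∀ i, d i ≠ 0) (h : (diagonal d * Y * diagonal d).PosDef) : Y.PosDef := by
  have hu : IsUnit (diagonal d) := by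
    rw [Matrix.isUnit_iff_isUnit_det, det_diagonal]
    exact (Finset.prod_ne_zero_iff.2 fun i _ => hd i).isUnit
  rw [← Matrix.IsUnit.posDef_star_left_conjugate_iff hu]
  simpa [star_eq_conjTranspose, diagonal_conjTranspose] using h

theorem Matrix.abs_sum_mul_le {H : Matrix ι ι ℝ} {c : ℝ} (hH : ∀ i j, |H i j| ≤ c)
    (x : ι → ℝ) : |∑ i, ∑ j, H i j * (x i * x j)| ≤ Fintype.card ι * c * ∑ i, x i ^ 2 := by
  have h1 : ∀ i j, |H i j * (x i * x j)| ≤ c * ((x i ^ 2 + x j ^ 2) / 2) := fun i j => by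
    rw [abs_mul]
    refine mul_le_mul (hH i j) ?_ (abs_nonneg _) ((abs_nonneg _).trans (hH i j))
    rw [abs_le]
    constructor <;> nlinarith [sq_nonneg (x i + x j), sq_nonneg (x i - x j)]
  calc |∑ i, ∑ j, H i j * (x i * x j)| ≤ ∑ i, ∑ j, c * ((x i ^ 2 + x j ^ 2) / 2) :=
        (Finset.abs_sum_le_sum_abs _ _).trans <| Finset.sum_le_sum fun i _ =>
          (Finset.abs_sum_le_sum_abs _ _).trans <| Finset.sum_le_sum fun j _ => h1 i j
    _ = _ := by
      simp only [← Finset.mul_sum, ← Finset.sum_div, Finset.sum_add_distrib, Finset.sum_const,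
        Finset.card_univ, nsmul_eq_mul]
      ring

/-- If `G = sY + H` is positive semidefinite and `H` is bounded in terms of the weights `n`, then
the rescaled matrix of `Y` has no eigenvalue far below `0`. -/
theorem Matrix.exists_scaled [DecidableEq ι] {Y : Matrix ι ι ℝ} (hY : Y.IsHermitian) {G H : Matrix ι ι ℝ}
    {s c : ℝ} (hs : 0 < s) (hG : ∀ x : ι → ℝ, 0 ≤ ∑ i, ∑ j, G i j * (x i * x j))
    (hGH : ∀ i j, G i j - H i j = s * Y i j) {n : ι → ℝ} (hn : ∀ i, 0 < n i)
    (hdiag : ∀ i, Y i i = c * n i)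
    (hH : ∀ i j, H i j ^ 2 ≤ c ^ 2 * (n i * n j)) (hc : 0 ≤ c) :
    ∃ (Z : Matrix ι ι ℝ) (hZ : Z.IsHermitian), (Z.PosDef → Y.PosDef) ∧
      (∀ i, -(Fintype.card ι * c / s) ≤ hZ.eigenvalues i) ∧ Z.trace = Fintype.card ι * c ∧
      Y.det = (∏ i, n i) * Z.det := by
  -- Conjugation by diag(n_i^(-1/2)) makes all diagonal entries of Y equal to c and bounds all
  -- entries of H by c.
  set d : ι → ℝ := fun i => (√(n i))⁻¹ with hd
  have hd0 : ∀ i, d i ≠ 0 := fun i => inv_ne_zero (Real.sqrt_pos.2 (hn i)).ne'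
  have hdn : ∀ i, d i ^ 2 * n i = 1 := fun i => by
    rw [hd]; simp only [inv_pow]; rw [Real.sq_sqrt (hn i).le, inv_mul_cancel₀ (hn i).ne']
  have hent : ∀ (A : Matrix ι ι ℝ) i j, (diagonal d * A * diagonal d) i j = d i * A i j * d j :=
    fun A i j => by rw [mul_diagonal, diagonal_mul]
  have hZ : (diagonal d * Y * diagonal d).IsHermitian := by
    ext i j
    rw [conjTranspose_apply, hent, hent, star_trivial]
    have := hY.apply i j
    rw [star_trivial] at this
    rw [this]; ring
  refine ⟨_, hZ, posDef_of_diagonal_mul_mul_diagonal hd0, hZ.neg_le_eigenvalues fun x => ?_, ?_, ?_⟩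
  · have h1 := hG fun i => d i * x i
    have h2 : ∀ i j, |(diagonal d * H * diagonal d) i j| ≤ c := fun i j => by
      rw [hent]
      apply abs_le_of_sq_le_sq _ hc
      calc (d i * H i j * d j) ^ 2 = (d i ^ 2 * d j ^ 2) * H i j ^ 2 := by ring
        _ ≤ (d i ^ 2 * d j ^ 2) * (c ^ 2 * (n i * n j)) := by gcongr; exact hH i j
        _ = c ^ 2 * (d i ^ 2 * n i) * (d j ^ 2 * n j) := by ring
        _ = c ^ 2 := by rw [hdn, hdn]; ring
    have h3 := abs_le.1 (abs_sum_mul_le h2 x)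
    have h4 : ∑ i, ∑ j, G i j * (d i * x i * (d j * x j)) =
        s * ∑ i, ∑ j, (diagonal d * Y * diagonal d) i j * (x i * x j) +
          ∑ i, ∑ j, (diagonal d * H * diagonal d) i j * (x i * x j) := by
      simp only [Finset.mul_sum, ← Finset.sum_add_distrib, hent]
      refine Finset.sum_congr rfl fun i _ => Finset.sum_congr rfl fun j _ => ?_
      linear_combination (d i * x i * (d j * x j)) * hGH i j
    rw [h4] at h1
    have h5 : 0 ≤ s * (∑ i, ∑ j, (diagonal d * Y * diagonal d) i j * (x i * x j) +
        Fintype.card ι * c / s * ∑ i, x i ^ 2) := by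
      have : s * (Fintype.card ι * c / s * ∑ i, x i ^ 2) = Fintype.card ι * c * ∑ i, x i ^ 2 := by
        field_simp
      rw [mul_add, this]
      linarith [h3.2]
    exact nonneg_of_mul_nonneg_right h5 hs
  · rw [trace]
    simp only [diag_apply, hent, hdiag]
    rw [Finset.sum_congr rfl (g := fun _ => c) fun i _ => by linear_combination c * hdn i]
    simp
  · rw [det_mul, det_mul, det_diagonal]
    have h1 : (∏ i, n i) * (∏ i, d i) ^ 2 = 1 := by
      rw [← Finset.prod_pow, ← Finset.prod_mul_distrib]
      exact Finset.prod_eq_one fun i _ => by rw [mul_comm]; exact hdn i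
    linear_combination (-Y.det) * h1

end Scaling

theorem one_le_abs_intCast_det {ι : Type*} [Fintype ι] [DecidableEq ι] {Y : Matrix ι ι ℤ}
    (hY : Y.det ≠ 0) : 1 ≤ |(Y.map (Int.cast : ℤ → ℝ)).det| := by
  have h : (Y.map (Int.cast : ℤ → ℝ)).det = Y.det := by
    rw [Int.cast_det]
  rw [h]
  exact_mod_cast Int.one_le_abs hY

/-- The rescaled determinant is at least 1/(2C) in absolute value. With μ = 3m/s ≤ m/30 it suffices
that μ (2m)² · 2C < 1, and s ≥ 45Cm³ makes this at most 24/45. -/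
theorem posDef_intCast_fin_three {Y : Matrix (Fin 3) (Fin 3) ℤ} (hY : Y.IsSymm)
    {G H : Matrix (Fin 3) (Fin 3) ℝ} {s m C : ℝ} (hm : 1 ≤ m) (hC : 2 ≤ C)
    (hs : 45 * C * m ^ 3 ≤ s)
    (hG : ∀ x : Fin 3 → ℝ, 0 ≤ ∑ i, ∑ j, G i j * (x i * x j))
    (hGH : ∀ i j, G i j - H i j = s * Y i j)
    (hdiag : ∀ i, (Y i i : ℝ) = m * ![1, 2, C] i)
    (hH : ∀ i j, H i j ^ 2 ≤ m ^ 2 * (![1, 2, C] i * ![1, 2, C] j))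
    (hdet : Y.det ≠ 0) : (Y.map (Int.cast : ℤ → ℝ)).PosDef := by
  have hm3 : 1 ≤ m ^ 3 := one_le_pow₀ hm
  have hs0 : 90 * m ^ 3 ≤ s := by nlinarith
  have hspos : 0 < s := by linarith
  obtain ⟨Z, hZ, hZY, hμ, htr, hd⟩ := Matrix.exists_scaled (Y := Y.map (Int.cast : ℤ → ℝ))
    (n := ![1, 2, C]) (c := m)
    (by ext i j; simp [Matrix.conjTranspose_apply, hY.apply i j]) hspos hG hGH
    (by intro i; fin_cases i <;> simp; linarith) hdiag hH (by linarith)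
  refine hZY (hZ.posDef_fin_three hμ ?_)
  have h1 := one_le_abs_intCast_det hdet
  rw [hd, abs_mul] at h1
  simp only [Fin.prod_univ_three, Matrix.cons_val, one_mul] at h1
  rw [abs_of_pos (by linarith : 0 < 2 * C)] at h1
  rw [htr]
  simp only [Fintype.card_fin, Nat.cast_ofNat]
  set μ := 3 * m / s with hμd
  have hμs : μ * s = 3 * m := by rw [hμd]; field_simp
  have hμ0 : 0 < μ := by positivity
  have hμ1 : μ ≤ m / 30 := by
    rw [hμd, div_le_iff₀ hspos]
    nlinarith [sq_nonneg (m - 1)]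
  have h2 : ((3 * m + 5 * μ) / 2) ^ 2 ≤ (2 * m) ^ 2 := by
    apply pow_le_pow_left₀ <;> linarith
  have h3 : μ * (45 * C * m ^ 3) ≤ 3 * m := by rw [← hμs]; gcongr
  have h4 : μ * (2 * m) ^ 2 * (2 * C) < 1 := by
    have h5 : m * (μ * (2 * m) ^ 2 * (2 * C)) < m * 1 := by nlinarith
    exact lt_of_mul_lt_mul_left h5 (by linarith)
  have h5 : μ * ((3 * m + 5 * μ) / 2) ^ 2 * (2 * C) < |Z.det| * (2 * C) := by
    calc _ ≤ μ * (2 * m) ^ 2 * (2 * C) := by gcongr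
      _ < 1 := h4
      _ ≤ _ := by linarith
  exact lt_of_mul_lt_mul_right h5 (by linarith)

/-- Here μ = 4m/s ≤ m/100, so trace + 7μ ≤ 4.1m. The constant 200 brings μ (4.1m)³/4 · 2CE below
0.7. -/
theorem posDef_intCast_fin_four {Y : Matrix (Fin 4) (Fin 4) ℤ} (hY : Y.IsSymm)
    {G H : Matrix (Fin 4) (Fin 4) ℝ} {s m C E : ℝ} (hm : 1 ≤ m) (hC : 2 ≤ C) (hE : 1 ≤ E)
    (hs : 200 * C * E * m ^ 4 ≤ s)
    (hG : ∀ x : Fin 4 → ℝ, 0 ≤ ∑ i, ∑ j, G i j * (x i * x j))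
    (hGH : ∀ i j, G i j - H i j = s * Y i j)
    (hdiag : ∀ i, (Y i i : ℝ) = m * ![1, 2, C, E] i)
    (hH : ∀ i j, H i j ^ 2 ≤ m ^ 2 * (![1, 2, C, E] i * ![1, 2, C, E] j))
    (hdet : Y.det ≠ 0) : (Y.map (Int.cast : ℤ → ℝ)).PosDef := by
  have hm4 : m ≤ m ^ 4 := le_self_pow₀ hm (by norm_num)
  have hCE : 2 ≤ C * E := by nlinarith
  have hs0 : 400 * m ^ 4 ≤ s := by nlinarith
  have hspos : 0 < s := by linarith
  obtain ⟨Z, hZ, hZY, hμ, htr, hd⟩ := Matrix.exists_scaled (Y := Y.map (Int.cast : ℤ → ℝ))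
    (n := ![1, 2, C, E]) (c := m)
    (by ext i j; simp [Matrix.conjTranspose_apply, hY.apply i j]) hspos hG hGH
    (by intro i; fin_cases i <;> simp <;> linarith) hdiag hH (by linarith)
  refine hZY (hZ.posDef_fin_four hμ ?_)
  have h1 := one_le_abs_intCast_det hdet
  rw [hd, abs_mul] at h1
  simp only [Fin.prod_univ_four, Matrix.cons_val, one_mul] at h1
  rw [abs_of_pos (by positivity : 0 < 2 * C * E)] at h1
  rw [htr]
  simp only [Fintype.card_fin, Nat.cast_ofNat]
  set μ := 4 * m / s with hμd
  have hμs : μ * s = 4 * m := by rw [hμd]; field_simp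
  have hμ0 : 0 < μ := by positivity
  have hμ1 : μ ≤ m / 100 := by
    rw [hμd, div_le_iff₀ hspos]
    nlinarith
  have h2 : (4 * m + 7 * μ) ^ 3 ≤ (4.1 * m) ^ 3 := by
    apply pow_le_pow_left₀ <;> linarith
  have h3 : μ * (200 * C * E * m ^ 4) ≤ 4 * m := by rw [← hμs]; gcongr
  have h4 : μ * (4.1 * m) ^ 3 / 4 * (2 * C * E) < 1 := by
    have h5 : m * (μ * (4.1 * m) ^ 3 / 4 * (2 * C * E)) < m * 1 := by nlinarith
    exact lt_of_mul_lt_mul_left h5 (by linarith)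
  have h5 : μ * (4 * m + 7 * μ) ^ 3 / 4 * (2 * C * E) < |Z.det| * (2 * C * E) := by
    calc _ ≤ μ * (4.1 * m) ^ 3 / 4 * (2 * C * E) := by gcongr
      _ < 1 := h4
      _ ≤ _ := by linarith
  exact lt_of_mul_lt_mul_right h5 (by positivity)

/-! ### Integers and embeddings of ℚ(√D) -/

namespace QuadField

theorem irrational_sqrt {D : ℕ} (hD1 : D ≠ 1) (hDsq : Squarefree D) : Irrational √(D : ℝ) := by
  rw [irrational_sqrt_natCast_iff]
  rintro ⟨k, rfl⟩
  have := Nat.isUnit_iff.1 (hDsq k dvd_rfl)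
  subst this
  exact hD1 rfl

theorem sq_sqrt (D : ℕ) : √(D : ℝ) ^ 2 = D := Real.sq_sqrt (Nat.cast_nonneg D)

theorem isIntegral_sqrt (D : ℕ) : IsIntegral ℤ √(D : ℝ) := by
  refine IsIntegral.of_pow (n := 2) two_pos ?_
  rw [sq_sqrt]
  exact isIntegral_algebraMap (R := ℤ) (x := (D : ℤ))

theorem exists_eq_add_mul_sqrt {D : ℕ} (hD : Irrational √(D : ℝ)) (x : QuadField D) :
    ∃ r t : ℚ, (x : ℝ) = r + t * √(D : ℝ) := by
  obtain ⟨x, hx⟩ := x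
  change ∃ r t : ℚ, x = r + t * √(D : ℝ)
  induction hx using IntermediateField.adjoin_induction with
  | mem x hx =>
    rw [Set.mem_singleton_iff] at hx
    exact ⟨0, 1, by simp [hx]⟩
  | algebraMap q => exact ⟨q, 0, by simp⟩
  | add x y _ _ hx hy =>
    obtain ⟨r, t, rfl⟩ := hx
    obtain ⟨r', t', rfl⟩ := hy
    exact ⟨r + r', t + t', by push_cast; ring⟩
  | inv x _ hx =>
    obtain ⟨r, t, rfl⟩ := hx
    by_cases h0 : (r : ℝ) + t * √(D : ℝ) = 0
    · exact ⟨0, 0, by simp [h0]⟩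
    have h1 : (r : ℝ) - t * √(D : ℝ) ≠ 0 := fun h => by
      by_cases ht : t = 0
      · subst ht; apply h0; simpa using h
      · refine hD ⟨r / t, ?_⟩
        push_cast
        have : (t : ℝ) ≠ 0 := by exact_mod_cast ht
        field_simp
        linarith
    have h2 : ((r ^ 2 - D * t ^ 2 : ℚ) : ℝ) = (r + t * √(D : ℝ)) * (r - t * √(D : ℝ)) := by
      push_cast
      linear_combination (t : ℝ) ^ 2 * sq_sqrt D
    refine ⟨r / (r ^ 2 - D * t ^ 2), -t / (r ^ 2 - D * t ^ 2), ?_⟩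
    rw [Rat.cast_div, Rat.cast_div, h2]
    push_cast
    field_simp
    ring
  | mul x y _ _ hx hy =>
    obtain ⟨r, t, rfl⟩ := hx
    obtain ⟨r', t', rfl⟩ := hy
    exact ⟨r * r' + D * (t * t'), r * t' + t * r', by
      push_cast; linear_combination (t * t' : ℝ) * sq_sqrt D⟩

/-- `√D` as an element of `ℚ(√D)`. -/
noncomputable abbrev root (D : ℕ) : QuadField D := AdjoinSimple.gen ℚ √(D : ℝ)

theorem coe_root (D : ℕ) : ((root D : QuadField D) : ℝ) = √(D : ℝ) := rfl

theorem eq_add_mul_root {D : ℕ} {x : QuadField D} {r t : ℚ} (h : (x : ℝ) = r + t * √(D : ℝ)) :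
    x = (r : QuadField D) + t * root D := by
  apply Subtype.ext
  rw [h]
  push_cast
  rfl

theorem map_eq {D : ℕ} {x : QuadField D} {r t : ℚ} (h : (x : ℝ) = r + t * √(D : ℝ))
    (σ : QuadField D →+* ℝ) : σ x = r + t * σ (root D) := by
  rw [eq_add_mul_root h, map_add, map_mul, map_ratCast, map_ratCast]

theorem root_sq (D : ℕ) : root D ^ 2 = (D : QuadField D) := by
  apply Subtype.ext
  push_cast
  exact sq_sqrt D

theorem map_root (D : ℕ) (σ : QuadField D →+* ℝ) :
    σ (root D) = √(D : ℝ) ∨ σ (root D) = -√(D : ℝ) := by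
  apply sq_eq_sq_iff_eq_or_eq_neg.1
  rw [← map_pow, root_sq, map_natCast, sq_sqrt]

theorem exists_conj {D : ℕ} (hD : Irrational √(D : ℝ)) :
    ∃ σ : QuadField D →+* ℝ, σ (root D) = -√(D : ℝ) := by
  have hint : IsIntegral ℚ √(D : ℝ) := (isIntegral_sqrt D).tower_top
  have hmin : minpoly ℚ √(D : ℝ) = Polynomial.X ^ 2 - Polynomial.C (D : ℚ) := by
    have hdvd : minpoly ℚ √(D : ℝ) ∣ Polynomial.X ^ 2 - Polynomial.C (D : ℚ) := by
      apply minpoly.dvd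
      simp
    have hmonic : (Polynomial.X ^ 2 - Polynomial.C (D : ℚ)).Monic :=
      Polynomial.monic_X_pow_sub_C _ two_ne_zero
    refine (Polynomial.eq_of_monic_of_dvd_of_natDegree_le (minpoly.monic hint) hmonic hdvd ?_).symm
    rw [Polynomial.natDegree_X_pow_sub_C]
    rw [minpoly.two_le_natDegree_iff hint]
    rintro ⟨q, hq⟩
    exact hD ⟨q, hq⟩
  refine ⟨((algHomAdjoinIntegralEquiv ℚ (K := ℝ) hint).symm ⟨-√(D : ℝ), ?_⟩ :
    QuadField D →ₐ[ℚ] ℝ).toRingHom, algHomAdjoinIntegralEquiv_symm_apply_gen ℚ hint _⟩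
  rw [Polynomial.mem_aroots, hmin]
  exact ⟨Polynomial.X_pow_sub_C_ne_zero two_pos _, by simp⟩

theorem isInt_of_isIntegral {q : ℚ} (h : IsIntegral ℤ (q : ℝ)) : ∃ k : ℤ, (q : ℝ) = k := by
  have h1 : IsIntegral ℤ q := by
    rw [← isIntegral_algebraMap_iff (algebraMap ℚ ℝ).injective (R := ℤ)]
    simpa using h
  obtain ⟨k, hk⟩ := IsIntegrallyClosed.isIntegral_iff.1 h1
  exact ⟨k, by rw [← hk]; simp⟩

theorem sqrt_quadDisc_of_mod_four {D : ℕ} (h : D % 4 = 1) : √(quadDisc D : ℝ) = √(D : ℝ) := by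
  rw [quadDisc, if_pos h]

theorem sqrt_quadDisc_of_mod_four_ne {D : ℕ} (h : D % 4 ≠ 1) :
    √(quadDisc D : ℝ) = 2 * √(D : ℝ) := by
  rw [quadDisc, if_neg h]
  push_cast
  rw [Real.sqrt_mul (by norm_num), show (4 : ℝ) = 2 ^ 2 by norm_num, Real.sqrt_sq (by norm_num)]

theorem exists_int_of_squarefree_mul_sq {D : ℕ} (hDsq : Squarefree D) {u : ℚ} {n : ℤ}
    (h : D * u ^ 2 = n) : ∃ a : ℤ, u = a := by
  have hden : (u.den : ℚ) ≠ 0 := by exact_mod_cast u.den_ne_zero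
  have h1 : (D : ℚ) * u.num ^ 2 = n * u.den ^ 2 := by
    rw [← h]
    nth_rewrite 2 [← Rat.num_div_den u]
    field_simp
  have h2 : (D : ℤ) * u.num ^ 2 = n * u.den ^ 2 := by exact_mod_cast h1
  have hcop : IsCoprime ((u.den : ℤ) ^ 2) (u.num ^ 2) :=
    (Int.isCoprime_iff_gcd_eq_one.2 (by
      rw [Int.gcd_comm]; exact u.reduced)).pow
  have h3 : (u.den : ℤ) ^ 2 ∣ D := hcop.dvd_of_dvd_mul_right ⟨n, by rw [h2]; ring⟩
  have h4 : u.den * u.den ∣ D := by rw [← pow_two]; exact_mod_cast h3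
  have h5 := Nat.isUnit_iff.1 (hDsq _ h4)
  exact ⟨u.num, (Rat.den_eq_one_iff u).1 h5 |>.symm⟩

/-- The different of `ℚ(√D)` is generated by `√Δ_D`. -/
theorem exists_int_sub_conj {D : ℕ} (hDsq : Squarefree D)
    (hD : Irrational √(D : ℝ)) {σ : QuadField D →+* ℝ} (hσ : σ (root D) = -√(D : ℝ))
    (β : 𝓞 (QuadField D)) :
    ∃ k : ℤ, ((β : QuadField D) : ℝ) - σ β = √(quadDisc D : ℝ) * k := by
  obtain ⟨r, t, hrt⟩ := exists_eq_add_mul_sqrt hD (β : QuadField D)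
  have hσβ : σ β = r - t * √(D : ℝ) := by rw [map_eq hrt, hσ]; ring
  have hi1 : IsIntegral ℤ ((β : QuadField D) : ℝ) :=
    β.isIntegral_coe.map (QuadField D).val
  have hi2 : IsIntegral ℤ (σ β) := map_isIntegral_int σ β.isIntegral_coe
  obtain ⟨c, hc⟩ : ∃ c : ℤ, ((2 * r : ℚ) : ℝ) = c := isInt_of_isIntegral (by
    have : ((2 * r : ℚ) : ℝ) = ((β : QuadField D) : ℝ) + σ β := by
      rw [hrt, hσβ]; push_cast; ring
    rw [this]; exact hi1.add hi2)
  obtain ⟨n, hn⟩ : ∃ n : ℤ, ((r ^ 2 - D * t ^ 2 : ℚ) : ℝ) = n := isInt_of_isIntegral (by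
    have : ((r ^ 2 - D * t ^ 2 : ℚ) : ℝ) = ((β : QuadField D) : ℝ) * σ β := by
      rw [hrt, hσβ]; push_cast; linear_combination (t : ℝ) ^ 2 * sq_sqrt D
    rw [this]; exact hi1.mul hi2)
  have hc' : 2 * r = c := by exact_mod_cast hc
  have hn' : r ^ 2 - D * t ^ 2 = n := by exact_mod_cast hn
  have hu : (D : ℚ) * (2 * t) ^ 2 = ((c ^ 2 - 4 * n : ℤ) : ℚ) := by
    push_cast; rw [← hc', ← hn']; ring
  obtain ⟨a, ha⟩ := exists_int_of_squarefree_mul_sq hDsq hu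
  have ha' : 2 * (t : ℝ) = a := by exact_mod_cast ha
  have hsub : ((β : QuadField D) : ℝ) - σ β = √(D : ℝ) * a := by
    rw [hrt, hσβ, ← ha']; ring
  by_cases h4 : D % 4 = 1
  · exact ⟨a, by rw [hsub, sqrt_quadDisc_of_mod_four h4]⟩
  · have h40 : D % 4 ≠ 0 := fun h0 => by
      have := hDsq 2 (Nat.dvd_of_mod_eq_zero h0)
      simp at this
    rw [ha] at hu
    have hu' : (D : ℤ) * a ^ 2 = c ^ 2 - 4 * n := by exact_mod_cast hu
    -- For odd a, reduction modulo 4 would give D ≡ c², so D ≡ 0 or 1; both are excluded.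
    have hev : Even a := by
      by_contra hodd
      rw [Int.not_even_iff_odd] at hodd
      obtain ⟨b, rfl⟩ := hodd
      obtain ⟨f, hf⟩ : ∃ f : ℤ, f = b ^ 2 + b := ⟨_, rfl⟩
      have h5 : (D : ℤ) + 4 * (D * f) = c ^ 2 - 4 * n := by rw [← hu', hf]; ring
      rcases Int.even_or_odd' c with ⟨g, rfl | rfl⟩
      · have : (2 * g) ^ 2 = 4 * g ^ 2 := by ring
        omega
      · have : (2 * g + 1) ^ 2 = 4 * (g ^ 2 + g) + 1 := by ring
        omega
    obtain ⟨b, rfl⟩ := hev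
    exact ⟨b, by rw [hsub, sqrt_quadDisc_of_mod_four_ne h4]; push_cast; ring⟩

theorem exists_totallyPos {D : ℕ} {σ : QuadField D →+* ℝ} (hσ : σ (root D) = -√(D : ℝ)) :
    ∃ α : 𝓞 (QuadField D), IsTotallyPos (α : QuadField D) ∧
      ((α : QuadField D) : ℝ) - σ α = √(quadDisc D : ℝ) ∧ 0 < σ α ∧ σ α ≤ 1 := by
  obtain ⟨ω, r, t, hω, ht, hsub⟩ : ∃ (ω : 𝓞 (QuadField D)) (r t : ℚ),
      ((ω : QuadField D) : ℝ) = r + t * √(D : ℝ) ∧ 0 ≤ t ∧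
      2 * t * √(D : ℝ) = √(quadDisc D : ℝ) := by
    by_cases h4 : D % 4 = 1
    · obtain ⟨n, hn⟩ : ∃ n : ℕ, D = 4 * n + 1 := ⟨D / 4, by omega⟩
      have hint : IsIntegral ℤ ((1 + root D) / 2 : QuadField D) := by
        refine ⟨Polynomial.X ^ 2 - Polynomial.X - Polynomial.C (n : ℤ), ?_, ?_⟩
        · monicity!
        · have h := root_sq D
          have hn' : (D : QuadField D) = 4 * n + 1 := by
            have := congrArg (Nat.cast : ℕ → QuadField D) hn
            push_cast at this; exact this
          rw [hn'] at h
          simp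
          linear_combination h / 4
      refine ⟨⟨_, hint⟩, 1 / 2, 1 / 2, ?_, by norm_num, ?_⟩
      · change (((1 + root D) / 2 : QuadField D) : ℝ) = _
        have h2 : ((2 : QuadField D) : ℝ) = 2 := rfl
        push_cast
        rw [coe_root, h2]
        ring
      · rw [sqrt_quadDisc_of_mod_four h4]; push_cast; ring
    · have hint : IsIntegral ℤ (root D : QuadField D) := by
        refine IsIntegral.of_pow (n := 2) two_pos ?_
        rw [root_sq]
        exact isIntegral_algebraMap (R := ℤ) (x := (D : ℤ))
      refine ⟨⟨_, hint⟩, 0, 1, ?_, by norm_num, ?_⟩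
      · change ((root D : QuadField D) : ℝ) = _
        rw [coe_root]; simp
      · rw [sqrt_quadDisc_of_mod_four_ne h4]; push_cast; ring
  -- This shift puts the conjugate into (0, 1]. The value in the other embedding is at least as
  -- large, so total positivity follows.
  set k : ℤ := 1 - ⌈σ ω⌉ with hk
  have hσω : σ ω = r - t * √(D : ℝ) := by rw [map_eq hω, hσ]; ring
  have hσα : σ ((ω + (k : 𝓞 (QuadField D)) : 𝓞 (QuadField D)) : QuadField D) = σ ω + k := by
    simp
  have hα : (((ω + (k : 𝓞 (QuadField D)) : 𝓞 (QuadField D)) : QuadField D) : ℝ) =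
      ((ω : QuadField D) : ℝ) + k := by
    simp
  have hlt : 0 < σ ω + k := by
    have := Int.ceil_lt_add_one (σ ω)
    rw [hk]; push_cast; linarith
  refine ⟨ω + k, ?_, ?_, ?_, ?_⟩
  · intro τ
    have h1 : τ ((ω + (k : 𝓞 (QuadField D)) : 𝓞 (QuadField D)) : QuadField D) = τ ω + k := by simp
    rw [h1, map_eq hω]
    rw [hσω] at hlt
    have ht' : 0 ≤ (t : ℝ) * √(D : ℝ) := by positivity
    rcases map_root D τ with h | h <;> rw [h] <;> linarith
  · rw [hα, hσα, hω, hσω, ← hsub]; ring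
  · rw [hσα]; exact hlt
  · rw [hσα, hk]
    have := Int.le_ceil (σ ω)
    push_cast; linarith

end QuadField

/-! ### Bilinear forms, Gram matrices and independence -/

/-- The symmetric bilinear form `B` with `B(x, x) = Q(x)`. -/
noncomputable def QuadraticForm.bilin {F V : Type*} [Field F] [AddCommGroup V] [Module F V]
    (Q : QuadraticForm F V) (x y : V) : F :=
  QuadraticMap.polar Q x y / 2

namespace QuadraticForm

variable {F V : Type*} [Field F] [AddCommGroup V] [Module F V]
  (Q : QuadraticForm F V)

theorem bilin_self [CharZero F] (x : V) : Q.bilin x x = Q x := by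
  rw [bilin, QuadraticMap.polar_self]
  simp

theorem bilin_comm (x y : V) : Q.bilin x y = Q.bilin y x := by
  rw [bilin, QuadraticMap.polar_comm, bilin]

theorem bilin_sum_right {ι : Type*} [Fintype ι] (y : V) (x : ι → V) (a : ι → F) :
    Q.bilin y (∑ i, a i • x i) = ∑ i, Q.bilin y (x i) * a i := by
  simp only [bilin]
  rw [← QuadraticMap.polarBilin_apply_apply, map_sum, Finset.sum_div]
  refine Finset.sum_congr rfl fun i _ => ?_
  rw [map_smul, smul_eq_mul, QuadraticMap.polarBilin_apply_apply]
  ring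

theorem map_sum_smul [CharZero F] {ι : Type*} [Fintype ι] (x : ι → V) (a : ι → F) :
    Q (∑ i, a i • x i) = ∑ i, ∑ j, Q.bilin (x i) (x j) * (a i * a j) := by
  rw [← bilin_self, bilin_sum_right]
  refine Finset.sum_congr rfl fun i _ => ?_
  rw [bilin_comm, bilin_sum_right, Finset.sum_mul]
  exact Finset.sum_congr rfl fun j _ => by ring

theorem linearIndependent_of_det_ne_zero {ι : Type*} [Fintype ι] [DecidableEq ι] {x : ι → V}
    (h : (Matrix.of fun i j => Q.bilin (x i) (x j)).det ≠ 0) : LinearIndependent F x := by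
  rw [Fintype.linearIndependent_iff]
  intro a ha
  have h1 := Matrix.eq_zero_of_mulVec_eq_zero h (v := a) (by
    ext i
    have := Q.bilin_sum_right (x i) x a
    rw [ha] at this
    simp only [Matrix.mulVec, dotProduct, Matrix.of_apply, Pi.zero_apply]
    rw [← this]
    simp [bilin, QuadraticMap.polar])
  exact fun i => congrFun h1 i

end QuadraticForm

namespace QuadLattice

variable {F : Type*} [Field F] {V : Type*} [AddCommGroup V] [Module F V]
  [Module (𝓞 F) V] {Q : QuadraticForm F V} {L : QuadLattice F Q}

theorem mem_space {x : V} (hx : x ∈ L.toSubmodule) : x ∈ L.space := Submodule.subset_span hx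

/-- Gram matrices are positive semidefinite in every real embedding. -/
theorem IsTotallyPosDef.gram_nonneg [CharZero F] (hL : L.IsTotallyPosDef) (σ : F →+* ℝ) {ι : Type*} [Fintype ι]
    {x : ι → V} (hx : ∀ i, x i ∈ L.space) (t : ι → ℝ) :
    0 ≤ ∑ i, ∑ j, σ (Q.bilin (x i) (x j)) * (t i * t j) := by
  -- Positivity is given only for vectors of FL. Rational coefficients are fixed by σ and dense, so
  -- continuity covers real ones.
  have hdense : DenseRange (fun (q : ι → ℚ) (i : ι) => (q i : ℝ)) :=
    DenseRange.piMap fun _ => Rat.denseRange_cast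
  have hclosed : IsClosed {t : ι → ℝ | 0 ≤ ∑ i, ∑ j, σ (Q.bilin (x i) (x j)) * (t i * t j)} :=
    isClosed_le continuous_const (by fun_prop)
  refine hdense.induction_on (p := fun t : ι → ℝ =>
    0 ≤ ∑ i, ∑ j, σ (Q.bilin (x i) (x j)) * (t i * t j)) t hclosed fun q => ?_
  have h1 : σ (Q (∑ i, (q i : F) • x i)) =
      ∑ i, ∑ j, σ (Q.bilin (x i) (x j)) * ((q i : ℝ) * (q j : ℝ)) := by
    rw [Q.map_sum_smul]
    simp
  rw [← h1]
  by_cases h0 : ∑ i, (q i : F) • x i = 0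
  · rw [h0]; simp
  · exact (hL _ (Submodule.sum_mem _ fun i _ => Submodule.smul_mem _ _ (hx i)) h0 σ).le

theorem IsTotallyPosDef.bilin_sq_le [CharZero F] (hL : L.IsTotallyPosDef) (σ : F →+* ℝ) {x y : V}
    (hx : x ∈ L.space) (hy : y ∈ L.space) : σ (Q.bilin x y) ^ 2 ≤ σ (Q x) * σ (Q y) := by
  have h : ∀ t : ℝ, 0 ≤ σ (Q x) * (t * t) + 2 * σ (Q.bilin x y) * t + σ (Q y) := fun t => by
    have := hL.gram_nonneg σ (x := ![x, y]) (by simp [Fin.forall_fin_two, hx, hy]) ![t, 1]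
    simp only [Fin.sum_univ_two, Matrix.cons_val, Q.bilin_self] at this
    rw [Q.bilin_comm y x] at this
    linarith
  have := discrim_le_zero h
  rw [discrim] at this
  linarith

/-- Suppose that two real embeddings `σ₁`, `σ₂` agree on the Gram matrix of a linearly independent
family `v` and on the products of `v` and `w`, and differ on the Gram matrix of `w` by a
positive definite matrix. Then `v` and `w` together are linearly independent. -/
theorem IsTotallyPosDef.linearIndependent_sumElim [CharZero F] (hL : L.IsTotallyPosDef) {σ₁ σ₂ : F →+* ℝ}
    {ι κ : Type*} [Fintype ι] [Fintype κ] {v : ι → V} {w : κ → V} (hv : ∀ i, v i ∈ L.space)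
    (hw : ∀ i, w i ∈ L.space) (hli : LinearIndependent F v)
    (hvv : ∀ i j, σ₁ (Q.bilin (v i) (v j)) = σ₂ (Q.bilin (v i) (v j)))
    (hvw : ∀ i j, σ₁ (Q.bilin (v i) (w j)) = σ₂ (Q.bilin (v i) (w j)))
    {Y : Matrix κ κ ℝ} (hY : Y.PosDef) {s : ℝ} (hs : 0 < s)
    (hww : ∀ i j, σ₁ (Q.bilin (w i) (w j)) - σ₂ (Q.bilin (w i) (w j)) = s * Y i j) :
    LinearIndependent F (Sum.elim v w) := by
  rw [Fintype.linearIndependent_iff] at hli ⊢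
  intro a ha
  have h1 : ∑ i, ∑ j, σ₁ (Q.bilin (Sum.elim v w i) (Sum.elim v w j)) * (σ₁ (a i) * σ₁ (a j))
      = 0 := by
    have := congrArg σ₁ (Q.map_sum_smul (Sum.elim v w) a)
    rw [ha] at this
    simpa using this.symm
  -- The σ₁-images of the coefficients are inserted into the σ₂-Gram form. The σ₁-form vanishes
  -- there and exceeds the σ₂-form by s times the form Y in the `w`-coordinates, so Y takes a value
  -- ≤ 0.
  have h2 := hL.gram_nonneg σ₂ (x := Sum.elim v w) (by rintro (i | i) <;> simp [hv, hw])
    (fun i => σ₁ (a i))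
  have hwv : ∀ i j, σ₁ (Q.bilin (w i) (v j)) = σ₂ (Q.bilin (w i) (v j)) := fun i j => by
    rw [Q.bilin_comm, hvw]
  have hsub : ∀ i j, σ₁ (Q.bilin (w i) (w j)) = σ₂ (Q.bilin (w i) (w j)) + s * Y i j :=
    fun i j => by rw [← hww]; ring
  simp only [Fintype.sum_sum_type, Sum.elim_inl, Sum.elim_inr, hvv, hvw, hwv, hsub, add_mul,
    Finset.sum_add_distrib] at h1 h2
  have h3 : s * ∑ i, ∑ j, Y i j * (σ₁ (a (Sum.inr i)) * σ₁ (a (Sum.inr j))) ≤ 0 := by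
    simp only [Finset.mul_sum, ← mul_assoc] at h1 h2 ⊢
    linarith
  have hc : (fun i => σ₁ (a (Sum.inr i))) = 0 := by
    by_contra hne
    have := hY.dotProduct_mulVec_pos hne
    rw [star_trivial, Matrix.dotProduct_mulVec_eq_sum] at this
    have := mul_pos hs this
    linarith
  have hc' : ∀ i, a (Sum.inr i) = 0 := fun i => by
    have := congrFun hc i
    simpa using this
  have ha' : ∑ i, a (Sum.inl i) • v i = 0 := by
    rw [Fintype.sum_sum_type] at ha
    simpa [hc'] using ha
  rintro (i | i)
  · exact hli _ ha' i
  · exact hc' i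

theorem card_le_rank [FiniteDimensional F V] {ι : Type*} [Fintype ι] {x : ι → V}
    (hx : ∀ i, x i ∈ L.space) (h : LinearIndependent F x) : Fintype.card ι ≤ L.rank := by
  have h1 : LinearIndependent F (fun i => (⟨x i, hx i⟩ : L.space)) :=
    LinearIndependent.of_comp L.space.subtype h
  exact h1.fintype_card_le_finrank

end QuadLattice

/-! ### Vectors of norm mn and mnα -/

/-- If two embeddings agree on an integer of `ℚ(√D)`, then it is a rational integer. -/
theorem QuadField.exists_int_of_eq_conj {D : ℕ} (hD : Irrational √(D : ℝ)) {σ : QuadField D →+* ℝ}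
    (hσ : σ (root D) = -√(D : ℝ)) (β : 𝓞 (QuadField D))
    (h : ((β : QuadField D) : ℝ) = σ β) : ∃ k : ℤ, (β : QuadField D) = k := by
  obtain ⟨r, t, hrt⟩ := exists_eq_add_mul_sqrt hD (β : QuadField D)
  rw [map_eq hrt, hσ, hrt] at h
  have ht : (t : ℝ) = 0 := by
    have h1 : (t : ℝ) * √(D : ℝ) = 0 := by linarith
    exact (mul_eq_zero.1 h1).resolve_right hD.ne_zero
  rw [ht, zero_mul, add_zero] at hrt
  have hi : IsIntegral ℤ ((β : QuadField D) : ℝ) := β.isIntegral_coe.map (QuadField D).val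
  rw [hrt] at hi
  obtain ⟨k, hk⟩ := isInt_of_isIntegral hi
  refine ⟨k, Subtype.ext ?_⟩
  rw [hrt, hk]
  simp

/-- (β₁ − β₂)² ≤ 2(β₁² + β₂²) < s² leaves no room for a nonzero multiple of s. -/
theorem int_eq_zero_of_sub_eq_mul {β₁ β₂ s M a₁ a₂ : ℝ} {k : ℤ}
    (h : β₁ - β₂ = s * k) (h₁ : β₁ ^ 2 ≤ M * a₁) (h₂ : β₂ ^ 2 ≤ M * a₂)
    (hlt : 2 * M * (a₁ + a₂) < s ^ 2) : k = 0 := by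
  by_contra hk
  have hk1 : (1 : ℝ) ≤ (k : ℝ) ^ 2 := by
    rw [← sq_abs]
    have : (1 : ℝ) ≤ |(k : ℝ)| := by exact_mod_cast Int.one_le_abs hk
    nlinarith
  have : (s * k) ^ 2 ≤ 2 * M * (a₁ + a₂) := by
    rw [← h]; nlinarith [sq_nonneg (β₁ + β₂)]
  nlinarith [sq_nonneg s]

/-- Irrationality of √2; it makes the Cauchy–Schwarz bounds at the indices 1, 2 strict. -/
theorem int_sq_ne_two_mul_sq {m : ℕ} (hm : 0 < m) (b : ℤ) : b ^ 2 ≠ 2 * (m : ℤ) ^ 2 := by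
  intro h
  have h' : (b : ℝ) ^ 2 = 2 * (m : ℝ) ^ 2 := by exact_mod_cast h
  have hm' : (m : ℝ) ≠ 0 := by positivity
  refine irrational_sqrt_two ⟨|b| / m, ?_⟩
  push_cast
  rw [eq_comm, Real.sqrt_eq_iff_mul_self_eq (by norm_num) (by positivity)]
  rw [div_mul_div_comm, abs_mul_abs_self]
  field_simp
  linarith

namespace QuadLattice

variable {F : Type*} [Field F] {V : Type*} [AddCommGroup V] [Module F V]
  [Module (𝓞 F) V] {Q : QuadraticForm F V} {L : QuadLattice F Q}

/-- Vectors `f n` and `g n` of a lattice over a real quadratic field with embeddings `σ₁`, `σ₂`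
and different `s`, such that `Q (f n) = m n` and `Q (g n) = m n α`. -/
structure Frame (L : QuadLattice F Q) (m : ℕ) where
  /-- The vectors of rational norm. -/
  f : ℕ → V
  /-- The vectors of norm proportional to `α`. -/
  g : ℕ → V
  /-- The first embedding. -/
  σ₁ : F →+* ℝ
  /-- The second embedding. -/
  σ₂ : F →+* ℝ
  /-- The generator of the different. -/
  s : ℝ
  /-- A totally positive integer with a small conjugate. -/
  α : F
  /-- The Gram matrix of the vectors `f n`. -/
  a : ℕ → ℕ → ℤ
  /-- The coefficients of `α` in the Gram matrix of the vectors `g n`. -/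
  y : ℕ → ℕ → ℤ
  hL : L.IsTotallyPosDef
  hm : 0 < m
  hs : 18 * (m : ℝ) ^ 2 ≤ s
  f_mem : ∀ n, f n ∈ L.space
  g_mem : ∀ n, g n ∈ L.space
  map_f : ∀ n, 0 < n → Q (f n) = (m * n : ℕ)
  map_g : ∀ n, 0 < n → Q (g n) = (m * n : ℕ) * α
  α_sub : σ₁ α - σ₂ α = s
  α_pos : 0 < σ₂ α
  α_le : σ₂ α ≤ 1
  bilin_f : ∀ n k : ℕ, 0 < n → 0 < k → n = k ∨ 4 * (m : ℝ) ^ 2 * n * k < s ^ 2 →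
    Q.bilin (f n) (f k) = a n k
  bilin_fg : ∀ n k : ℕ, 0 < n → 0 < k → 4 * (m : ℝ) ^ 2 * n * k ≤ s →
    σ₁ (Q.bilin (f n) (g k)) = σ₂ (Q.bilin (f n) (g k))
  bilin_g : ∀ n k : ℕ, σ₁ (Q.bilin (g n) (g k)) - σ₂ (Q.bilin (g n) (g k)) = s * y n k

/-- The data exist if the lattice represents `m n` and `m n α` for all positive integers `n`. -/
theorem exists_frame [CharZero F] (hL : L.IsTotallyPosDef) (hc : L.IsClassical)
    {m : ℕ} (hm : 0 < m) {σ₁ σ₂ : F →+* ℝ} {s : ℝ} (hs : 18 * (m : ℝ) ^ 2 ≤ s)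
    (hint : ∀ β : 𝓞 F, ∃ k : ℤ, σ₁ β - σ₂ β = s * k)
    (hrat : ∀ β : 𝓞 F, σ₁ β = σ₂ β → ∃ k : ℤ, (β : F) = k) {α : F}
    (hsub : σ₁ α - σ₂ α = s) (hα0 : 0 < σ₂ α) (hα1 : σ₂ α ≤ 1)
    (hf : ∀ n : ℕ, 0 < n → L.Represents ((m * n : ℕ) : F))
    (hg : ∀ n : ℕ, 0 < n → L.Represents ((m * n : ℕ) * α)) :
    ∃ E : Frame L m, E.s = s := by
  have hm1 : (1 : ℝ) ≤ (m : ℝ) ^ 2 := one_le_pow₀ (by exact_mod_cast hm)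
  have hf' : ∀ n : ℕ, ∃ v ∈ L.toSubmodule, 0 < n → Q v = ((m * n : ℕ) : F) := fun n => by
    by_cases hn : 0 < n
    · obtain ⟨v, hv, h⟩ := hf n hn
      exact ⟨v, hv, fun _ => h⟩
    · exact ⟨0, zero_mem _, fun h => absurd h hn⟩
  have hg' : ∀ n : ℕ, ∃ v ∈ L.toSubmodule, 0 < n → Q v = (m * n : ℕ) * α := fun n => by
    by_cases hn : 0 < n
    · obtain ⟨v, hv, h⟩ := hg n hn
      exact ⟨v, hv, fun _ => h⟩
    · exact ⟨0, zero_mem _, fun h => absurd h hn⟩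
  choose f f_mem map_f using hf'
  choose g g_mem map_g using hg'
  have hbil : ∀ x ∈ L.toSubmodule, ∀ y ∈ L.toSubmodule, ∃ β : 𝓞 F, Q.bilin x y = β :=
    fun x hx y hy => hc x hx y hy
  have hff : ∀ n k : ℕ, ∃ a : ℤ, 0 < n → 0 < k → n = k ∨ 4 * (m : ℝ) ^ 2 * n * k < s ^ 2 →
      Q.bilin (f n) (f k) = a := fun n k => by
    by_cases h : 0 < n ∧ 0 < k ∧ (n = k ∨ 4 * (m : ℝ) ^ 2 * n * k < s ^ 2)
    · obtain ⟨hn, hk, h⟩ := h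
      by_cases hnk : n = k
      · subst hnk
        exact ⟨(m * n : ℕ), fun _ _ _ => by rw [Q.bilin_self, map_f n hn]; simp⟩
      · have h := h.resolve_left hnk
        obtain ⟨β, hβ⟩ := hbil _ (f_mem n) _ (f_mem k)
        obtain ⟨l, hl⟩ := hint β
        have hcs := fun σ => hL.bilin_sq_le σ (mem_space (f_mem n)) (mem_space (f_mem k))
        rw [map_f n hn, map_f k hk, hβ] at hcs
        have h1 := hcs σ₁
        have h2 := hcs σ₂
        simp only [map_natCast, map_mul, Nat.cast_mul] at h1 h2
        have hl0 : l = 0 := int_eq_zero_of_sub_eq_mul (M := (m : ℝ) ^ 2 * n * k) (a₁ := 1) (a₂ := 1)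
          hl (by linarith) (by linarith) (by linarith)
        rw [hl0, Int.cast_zero, mul_zero, sub_eq_zero] at hl
        obtain ⟨a, ha⟩ := hrat β hl
        exact ⟨a, fun _ _ _ => hβ.trans ha⟩
    · exact ⟨0, fun hn hk h' => absurd ⟨hn, hk, h'⟩ h⟩
  have hgg : ∀ n k : ℕ, ∃ y : ℤ,
      σ₁ (Q.bilin (g n) (g k)) - σ₂ (Q.bilin (g n) (g k)) = s * y := fun n k => by
    obtain ⟨β, hβ⟩ := hbil _ (g_mem n) _ (g_mem k)
    rw [hβ]
    exact hint β
  choose a ha using hff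
  choose y hy using hgg
  refine ⟨⟨f, g, σ₁, σ₂, s, α, a, y, hL, hm, hs, fun n => mem_space (f_mem n),
    fun n => mem_space (g_mem n), map_f, map_g, hsub, hα0, hα1, ha, fun n k hn hk h => ?_, hy⟩, rfl⟩
  obtain ⟨β, hβ⟩ := hbil _ (f_mem n) _ (g_mem k)
  obtain ⟨l, hl⟩ := hint β
  have hcs := fun σ => hL.bilin_sq_le σ (mem_space (f_mem n)) (mem_space (g_mem k))
  rw [map_f n hn, map_g k hk, hβ] at hcs
  have h1 := hcs σ₁
  have h2 := hcs σ₂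
  simp only [map_natCast, map_mul, Nat.cast_mul] at h1 h2
  have hl0 : l = 0 := by
    refine int_eq_zero_of_sub_eq_mul (M := (m : ℝ) ^ 2 * n * k) (a₁ := σ₁ α) (a₂ := σ₂ α)
      hl (by linarith) (by linarith) ?_
    -- With M = m² n k and 4M ≤ s, this gives 2M(σ₁ α + σ₂ α) ≤ s(s + 2)/2 < s².
    have h3 : σ₁ α + σ₂ α ≤ s + 2 := by linarith
    have h4 : (0 : ℝ) < (m : ℝ) ^ 2 * n * k := by positivity
    nlinarith
  rw [hβ]
  rw [hl0, Int.cast_zero, mul_zero, sub_eq_zero] at hl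
  exact hl

namespace Frame

variable {m : ℕ} (E : Frame L m)

theorem one_le_cast (E : Frame L m) : (1 : ℝ) ≤ m := by exact_mod_cast E.hm

theorem s_pos : 0 < E.s := by
  have := E.hs
  have h1 : (1 : ℝ) ≤ (m : ℝ) ^ 2 := one_le_pow₀ E.one_le_cast
  linarith

theorem lt_sq_of_le {x : ℝ} (hx : x ≤ E.s) : x < E.s ^ 2 := by
  have := E.hs
  have h1 : (1 : ℝ) ≤ (m : ℝ) ^ 2 := one_le_pow₀ E.one_le_cast
  nlinarith

theorem a_self [CharZero F] {n : ℕ} (hn : 0 < n) : E.a n n = n * m := by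
  have h := E.bilin_f n n hn hn (Or.inl rfl)
  rw [Q.bilin_self, E.map_f n hn] at h
  rw [mul_comm]
  exact_mod_cast h.symm

theorem a_comm [CharZero F] {n k : ℕ} (hn : 0 < n) (hk : 0 < k)
    (h : n = k ∨ 4 * (m : ℝ) ^ 2 * n * k < E.s ^ 2) : E.a n k = E.a k n := by
  have h1 := E.bilin_f n k hn hk h
  have h2 := E.bilin_f k n hk hn (h.imp Eq.symm (fun h => by linarith))
  rw [Q.bilin_comm, h2] at h1
  exact_mod_cast h1.symm

theorem y_self [CharZero F] {n : ℕ} (hn : 0 < n) : E.y n n = n * m := by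
  have h := E.bilin_g n n
  rw [Q.bilin_self, E.map_g n hn, map_mul, map_mul, ← E.α_sub, map_natCast, map_natCast,
    ← mul_sub, E.α_sub, mul_comm] at h
  have := mul_left_cancel₀ E.s_pos.ne' h
  rw [mul_comm]
  exact_mod_cast this.symm

theorem y_comm (n k : ℕ) : E.y n k = E.y k n := by
  have h := E.bilin_g n k
  rw [Q.bilin_comm, E.bilin_g k n] at h
  exact_mod_cast (mul_left_cancel₀ E.s_pos.ne' h).symm

theorem σ₂_bilin_g_sq_le [CharZero F] {n k : ℕ} (hn : 0 < n) (hk : 0 < k) :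
    E.σ₂ (Q.bilin (E.g n) (E.g k)) ^ 2 ≤ (m : ℝ) ^ 2 * (n * k) := by
  have h := E.hL.bilin_sq_le E.σ₂ (E.g_mem n) (E.g_mem k)
  rw [E.map_g n hn, E.map_g k hk] at h
  simp only [map_natCast, map_mul, Nat.cast_mul] at h
  have h1 : E.σ₂ E.α ^ 2 ≤ 1 := pow_le_one₀ E.α_pos.le E.α_le
  have h2 : (0 : ℝ) ≤ (m : ℝ) ^ 2 * (n * k) := by positivity
  nlinarith

/-- The integral Gram matrix of the vectors `f (n i)`. -/
def gramF {ι : Type*} (n : ι → ℕ) : Matrix ι ι ℤ := Matrix.of fun i j => E.a (n i) (n j)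

/-- The coefficients of `α` in the Gram matrix of the vectors `g (n i)`. -/
def gramG {ι : Type*} (n : ι → ℕ) : Matrix ι ι ℤ := Matrix.of fun i j => E.y (n i) (n j)

theorem gramG_isSymm {ι : Type*} (n : ι → ℕ) : (E.gramG n).IsSymm := by
  ext i j
  exact E.y_comm _ _

section Gram

variable {ι : Type*} [CharZero F] {n : ι → ℕ}

theorem gramF_isSymm (hn : ∀ i, 0 < n i)
    (h : ∀ i j, n i = n j ∨ 4 * (m : ℝ) ^ 2 * n i * n j < E.s ^ 2) : (E.gramF n).IsSymm := by
  ext i j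
  exact E.a_comm (hn j) (hn i) (h j i)

/-- Supplies the sign needed in `exists_prime_det_fin_four_ne_zero`, which asks for a positive 3 × 3
determinant. -/
theorem gramF_det_nonneg [Fintype ι] [DecidableEq ι] (hn : ∀ i, 0 < n i)
    (h : ∀ i j, n i = n j ∨ 4 * (m : ℝ) ^ 2 * n i * n j < E.s ^ 2) : 0 ≤ (E.gramF n).det := by
  have hpsd : ((E.gramF n).map (Int.cast : ℤ → ℝ)).PosSemidef := by
    refine Matrix.PosSemidef.of_dotProduct_mulVec_nonneg ?_ fun x => ?_
    · ext i j
      simp [Matrix.conjTranspose_apply, (E.gramF_isSymm hn h).apply i j]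
    · rw [star_trivial, Matrix.dotProduct_mulVec_eq_sum]
      have := E.hL.gram_nonneg E.σ₁ (x := fun i => E.f (n i)) (fun i => E.f_mem _) x
      simp only [E.bilin_f _ _ (hn _) (hn _) (h _ _), map_intCast] at this
      exact this
  have h0 := hpsd.det_nonneg
  have h1 : ((E.gramF n).map (Int.cast : ℤ → ℝ)).det = (E.gramF n).det := by
    rw [Int.cast_det]
  rw [h1] at h0
  exact_mod_cast h0

theorem card_add_card_le_rank [FiniteDimensional F V] [Fintype ι] [DecidableEq ι] {κ : Type*}
    [Fintype κ] {k : κ → ℕ} (hn : ∀ i, 0 < n i)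
    (h : ∀ i j, n i = n j ∨ 4 * (m : ℝ) ^ 2 * n i * n j < E.s ^ 2) (hk : ∀ i, 0 < k i)
    (hnk : ∀ i j, 4 * (m : ℝ) ^ 2 * n i * k j ≤ E.s) (hF : (E.gramF n).det ≠ 0)
    (hG : ((E.gramG k).map (Int.cast : ℤ → ℝ)).PosDef) :
    Fintype.card ι + Fintype.card κ ≤ L.rank := by
  have hli : LinearIndependent F (fun i => E.f (n i)) := by
    apply Q.linearIndependent_of_det_ne_zero
    have : (Matrix.of fun i j => Q.bilin (E.f (n i)) (E.f (n j))) =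
        (E.gramF n).map (Int.cast : ℤ → F) := by
      ext i j
      exact E.bilin_f _ _ (hn _) (hn _) (h _ _)
    rw [this]
    have h1 : ((E.gramF n).map (Int.cast : ℤ → F)).det = (E.gramF n).det := by
      rw [Int.cast_det]
    rw [h1]
    exact_mod_cast hF
  have hli2 := E.hL.linearIndependent_sumElim (σ₁ := E.σ₁) (σ₂ := E.σ₂)
    (w := fun i => E.g (k i)) (fun i => E.f_mem _) (fun i => E.g_mem _) hli
    (fun i j => by rw [E.bilin_f _ _ (hn _) (hn _) (h _ _), map_intCast, map_intCast])
    (fun i j => E.bilin_fg _ _ (hn _) (hk _) (hnk _ _)) hG E.s_pos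
    (fun i j => E.bilin_g _ _)
  rw [← Fintype.card_sum]
  exact card_le_rank (by rintro (i | i) <;> simp [E.f_mem, E.g_mem]) hli2

end Gram

/-- Cauchy–Schwarz in both embeddings gives s|y| ≤ √2 m (s + 2). For s ≥ 18m² this rules out y² ≥
2m² + 1, and y² = 2m² is impossible. -/
theorem y_one_two_sq_lt [CharZero F] : E.y 1 2 ^ 2 < 2 * (m : ℤ) ^ 2 := by
  refine lt_of_le_of_ne ?_ (int_sq_ne_two_mul_sq E.hm _)
  by_contra! hlt
  have hlt' : (2 * (m : ℝ) ^ 2 + 1) ≤ (E.y 1 2 : ℝ) ^ 2 := by exact_mod_cast hlt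
  have hs := E.hs
  have hm1 : (1 : ℝ) ≤ (m : ℝ) ^ 2 := one_le_pow₀ E.one_le_cast
  have h1 := E.hL.bilin_sq_le E.σ₁ (E.g_mem 1) (E.g_mem 2)
  have h2 := E.σ₂_bilin_g_sq_le (n := 1) (k := 2) one_pos two_pos
  have h3 := E.bilin_g 1 2
  rw [E.map_g 1 one_pos, E.map_g 2 two_pos] at h1
  simp only [map_natCast, map_mul, Nat.cast_mul, Nat.cast_one, Nat.cast_two, map_one,
    map_ofNat] at h1 h2
  have hα := E.α_sub
  have hα1 := E.α_le
  have hα0 := E.α_pos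
  set β₁ := E.σ₁ (Q.bilin (E.g 1) (E.g 2))
  set β₂ := E.σ₂ (Q.bilin (E.g 1) (E.g 2))
  have h4 : β₁ ^ 2 ≤ 2 * (m : ℝ) ^ 2 * (E.s + 1) ^ 2 := by
    have : E.σ₁ E.α ^ 2 ≤ (E.s + 1) ^ 2 := pow_le_pow_left₀ (by linarith) (by linarith) _
    nlinarith
  have h5 : (E.s * E.y 1 2) ^ 2 ≤ 2 * (m : ℝ) ^ 2 * (E.s + 2) ^ 2 := by
    rw [← h3]
    have h6 : (-(2 * (β₁ * β₂))) ≤ 2 * (2 * (m : ℝ) ^ 2 * (E.s + 1)) := by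
      have h7 : (β₁ * β₂) ^ 2 ≤ (2 * (m : ℝ) ^ 2 * (E.s + 1)) ^ 2 := by
        calc (β₁ * β₂) ^ 2 = β₁ ^ 2 * β₂ ^ 2 := by ring
          _ ≤ (2 * (m : ℝ) ^ 2 * (E.s + 1) ^ 2) * ((m : ℝ) ^ 2 * (1 * 2)) := by gcongr
          _ = _ := by ring
      have := (abs_le.1 (abs_le_of_sq_le_sq h7 (by nlinarith))).1
      linarith
    nlinarith
  have h6 : (2 * (m : ℝ) ^ 2 + 1) * E.s ^ 2 ≤ 2 * (m : ℝ) ^ 2 * (E.s + 2) ^ 2 := by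
    nlinarith [sq_nonneg E.s]
  nlinarith

theorem a_one_two_sq_lt [CharZero F] : E.a 1 2 ^ 2 < 2 * (m : ℤ) ^ 2 := by
  refine lt_of_le_of_ne ?_ (int_sq_ne_two_mul_sq E.hm _)
  have h1 := E.hL.bilin_sq_le E.σ₁ (E.f_mem 1) (E.f_mem 2)
  have hs := E.hs
  rw [E.bilin_f 1 2 one_pos two_pos (Or.inr (E.lt_sq_of_le (by push_cast; nlinarith))),
    E.map_f 1 one_pos, E.map_f 2 two_pos] at h1
  simp only [map_natCast, map_intCast] at h1
  have h2 : E.a 1 2 ^ 2 ≤ ((m * 1 : ℕ) : ℤ) * ((m * 2 : ℕ) : ℤ) := by exact_mod_cast h1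
  push_cast at h2
  linarith

end Frame

end QuadLattice

/-! ### Definiteness of the g-block and size conditions -/

namespace QuadLattice

namespace Frame

variable {F : Type*} [Field F] {V : Type*} [AddCommGroup V] [Module F V]
  [Module (𝓞 F) V] {Q : QuadraticForm F V} {L : QuadLattice F Q} {m : ℕ} (E : Frame L m)

theorem posDef_gramG_two [CharZero F] : ((E.gramG ![1, 2]).map (Int.cast : ℤ → ℝ)).PosDef := by
  have hm := E.one_le_cast
  have hy : (E.y 1 2 : ℝ) ^ 2 < 2 * (m : ℝ) ^ 2 := by exact_mod_cast E.y_one_two_sq_lt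
  have h1 : (E.y 1 1 : ℝ) = m := by rw [E.y_self one_pos]; simp
  have h2 : (E.y 2 2 : ℝ) = 2 * m := by rw [E.y_self two_pos]; simp
  refine Matrix.PosDef.of_dotProduct_mulVec_pos ?_ fun x hx => ?_
  · ext i j
    simp [Matrix.conjTranspose_apply, (E.gramG_isSymm ![1, 2]).apply i j]
  · rw [star_trivial, Matrix.dotProduct_mulVec_eq_sum]
    simp only [Fin.sum_univ_two, Matrix.map_apply, gramG, Matrix.of_apply, Matrix.cons_val]
    rw [E.y_comm 2 1, h1, h2]
    set b : ℝ := (E.y 1 2 : ℝ)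
    have h3 : (m : ℝ) * (m * (x 0 * x 0) + b * (x 0 * x 1) +
        (b * (x 1 * x 0) + 2 * m * (x 1 * x 1))) =
        (m * x 0 + b * x 1) ^ 2 + (2 * (m : ℝ) ^ 2 - b ^ 2) * x 1 ^ 2 := by ring
    refine pos_of_mul_pos_right (a := (m : ℝ)) ?_ (by linarith)
    rw [h3]
    by_cases hx1 : x 1 = 0
    · have hx0 : x 0 ≠ 0 := fun h => hx (by ext i; fin_cases i <;> simp [h, hx1])
      rw [hx1]
      have : (m : ℝ) * x 0 ≠ 0 := mul_ne_zero (by linarith) hx0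
      linarith [sq_pos_iff.2 this]
    · have : 0 < (2 * (m : ℝ) ^ 2 - b ^ 2) := by linarith
      positivity

theorem posDef_gramG_one [CharZero F] : ((E.gramG ![1]).map (Int.cast : ℤ → ℝ)).PosDef := by
  have h := E.posDef_gramG_two.submatrix (e := ![(0 : Fin 2)])
    (Function.injective_of_subsingleton _)
  convert h using 1
  ext i j
  fin_cases i; fin_cases j
  rfl

theorem forall_fin_three {c : ℕ} (hc : 0 < c) : ∀ i, 0 < ![1, 2, c] i := by
  intro i; fin_cases i <;> simp [hc]

theorem forall_fin_four {c d : ℕ} (hc : 0 < c) (hd : 0 < d) : ∀ i, 0 < ![1, 2, c, d] i := by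
  intro i; fin_cases i <;> simp [hc, hd]

theorem posDef_gramG_three [CharZero F] {c : ℕ} (hc : 2 ≤ c) (hs : 45 * (c : ℝ) * (m : ℝ) ^ 3 ≤ E.s)
    (hdet : (E.gramG ![1, 2, c]).det ≠ 0) :
    ((E.gramG ![1, 2, c]).map (Int.cast : ℤ → ℝ)).PosDef := by
  have hpos := forall_fin_three (c := c) (by omega)
  have hcast : ∀ i, ((![1, 2, c] i : ℕ) : ℝ) = ![1, 2, (c : ℝ)] i := by
    intro i; fin_cases i <;> simp
  refine posDef_intCast_fin_three (C := c) (m := m) (E.gramG_isSymm _) E.one_le_cast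
    (by exact_mod_cast hc) hs
    (E.hL.gram_nonneg E.σ₁ (x := fun i => E.g (![1, 2, c] i)) (fun i => E.g_mem _))
    (H := Matrix.of fun i j => E.σ₂ (Q.bilin (E.g (![1, 2, c] i)) (E.g (![1, 2, c] j))))
    (fun i j => E.bilin_g _ _) (fun i => ?_) (fun i j => ?_) hdet
  · rw [← hcast, gramG, Matrix.of_apply, E.y_self (hpos i)]
    push_cast
    ring
  · rw [← hcast, ← hcast]
    exact E.σ₂_bilin_g_sq_le (hpos i) (hpos j)

theorem posDef_gramG_four [CharZero F] {c d : ℕ} (hc : 2 ≤ c) (hd : 1 ≤ d)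
    (hs : 200 * (c : ℝ) * (d : ℝ) * (m : ℝ) ^ 4 ≤ E.s)
    (hdet : (E.gramG ![1, 2, c, d]).det ≠ 0) :
    ((E.gramG ![1, 2, c, d]).map (Int.cast : ℤ → ℝ)).PosDef := by
  have hpos := forall_fin_four (c := c) (d := d) (by omega) hd
  have hcast : ∀ i, ((![1, 2, c, d] i : ℕ) : ℝ) = ![1, 2, (c : ℝ), (d : ℝ)] i := by
    intro i; fin_cases i <;> simp
  refine posDef_intCast_fin_four (C := c) (E := d) (m := m) (E.gramG_isSymm _) E.one_le_cast
    (by exact_mod_cast hc) (by exact_mod_cast hd) hs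
    (E.hL.gram_nonneg E.σ₁ (x := fun i => E.g (![1, 2, c, d] i)) (fun i => E.g_mem _))
    (H := Matrix.of fun i j => E.σ₂ (Q.bilin (E.g (![1, 2, c, d] i)) (E.g (![1, 2, c, d] j))))
    (fun i j => E.bilin_g _ _) (fun i => ?_) (fun i j => ?_) hdet
  · rw [← hcast, gramG, Matrix.of_apply, E.y_self (hpos i)]
    push_cast
    ring
  · rw [← hcast, ← hcast]
    exact E.σ₂_bilin_g_sq_le (hpos i) (hpos j)

theorem forall_lt_sq_fin_three {c : ℕ} (hc : 8 * (m : ℝ) ^ 2 * c < E.s ^ 2) (i j : Fin 3) :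
    ![1, 2, c] i = ![1, 2, c] j ∨
      4 * (m : ℝ) ^ 2 * (![1, 2, c] i : ℕ) * (![1, 2, c] j : ℕ) < E.s ^ 2 := by
  have h0 : 8 * (m : ℝ) ^ 2 < E.s ^ 2 := E.lt_sq_of_le (by
    have := E.hs
    have := sq_nonneg (m : ℝ)
    linarith)
  have h1 : (0 : ℝ) ≤ (m : ℝ) ^ 2 * c := by positivity
  fin_cases i <;> fin_cases j <;>
    first
    | exact Or.inl rfl
    | right; simp; linarith

theorem forall_lt_sq_fin_four {c d : ℕ} (hc : 8 * (m : ℝ) ^ 2 * c < E.s ^ 2)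
    (hd : 8 * (m : ℝ) ^ 2 * d < E.s ^ 2) (hcd : 4 * (m : ℝ) ^ 2 * c * d < E.s ^ 2) (i j : Fin 4) :
    ![1, 2, c, d] i = ![1, 2, c, d] j ∨
      4 * (m : ℝ) ^ 2 * (![1, 2, c, d] i : ℕ) * (![1, 2, c, d] j : ℕ) < E.s ^ 2 := by
  have h0 : 8 * (m : ℝ) ^ 2 < E.s ^ 2 := E.lt_sq_of_le (by
    have := E.hs
    have := sq_nonneg (m : ℝ)
    linarith)
  have h1 : (0 : ℝ) ≤ (m : ℝ) ^ 2 * c := by positivity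
  have h2 : (0 : ℝ) ≤ (m : ℝ) ^ 2 * d := by positivity
  fin_cases i <;> fin_cases j <;>
    first
    | exact Or.inl rfl
    | right; simp; linarith

end Frame

end QuadLattice

/-! ### Rank bounds and choice of constants -/

namespace QuadLattice

namespace Frame

variable {F : Type*} [Field F] {V : Type*} [AddCommGroup V] [Module F V]
  [Module (𝓞 F) V] {Q : QuadraticForm F V} {L : QuadLattice F Q} {m : ℕ} (E : Frame L m)

/-- The Gram matrix of the vectors `f (n i)` is integral and nonsingular as soon as their
inner products are forced to be rational. -/
def Admissible {ι : Type*} [Fintype ι] [DecidableEq ι] (n : ι → ℕ) : Prop :=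
  (∀ i j, n i = n j ∨ 4 * (m : ℝ) ^ 2 * n i * n j < E.s ^ 2) → (E.gramF n).det ≠ 0

theorem lt_of_rank_le_three [CharZero F] [FiniteDimensional F V] {c : ℕ} (hc : 2 ≤ c)
    (hF : E.Admissible ![1, 2, c]) (hr : L.rank ≤ 3) : E.s < 5 * (c : ℝ) * (m : ℝ) ^ 2 := by
  by_contra! hs
  have h18 := E.hs
  have hm2 : (1 : ℝ) ≤ (m : ℝ) ^ 2 := one_le_pow₀ E.one_le_cast
  have hmc : (0 : ℝ) ≤ (m : ℝ) ^ 2 * c := by positivity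
  have hlt := E.forall_lt_sq_fin_three (c := c) (by nlinarith)
  have := E.card_add_card_le_rank (forall_fin_three (by omega)) hlt
    (k := ![1]) (by simp) (fun i j => by
      fin_cases i <;> fin_cases j <;> simp <;> linarith) (hF hlt) E.posDef_gramG_one
  simp at this
  omega

/-- Vectors f(1), f(2), f(c), g(1), g(2) would be independent. The largest f–g index product is 2c,
and rationality there needs 8m²c ≤ s. -/
theorem lt_of_rank_le_four [CharZero F] [FiniteDimensional F V] {c : ℕ} (hc : 2 ≤ c)
    (hF : E.Admissible ![1, 2, c]) (hr : L.rank ≤ 4) : E.s < 9 * (c : ℝ) * (m : ℝ) ^ 2 := by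
  by_contra! hs
  have h18 := E.hs
  have hm2 : (1 : ℝ) ≤ (m : ℝ) ^ 2 := one_le_pow₀ E.one_le_cast
  have hmc : (0 : ℝ) ≤ (m : ℝ) ^ 2 * c := by positivity
  have hlt := E.forall_lt_sq_fin_three (c := c) (by nlinarith)
  have := E.card_add_card_le_rank (forall_fin_three (by omega)) hlt
    (k := ![1, 2]) (by simp [Fin.forall_fin_two]) (fun i j => by
      fin_cases i <;> fin_cases j <;> simp <;> linarith) (hF hlt) E.posDef_gramG_two
  simp at this
  omega

section Large

variable {c₁ c₂ : ℕ}

/-- The bound c₁ ≤ 7m gives 4m²c₁c₂ ≤ 28c₂m³, below 45c₂m³. This keeps c₁ out of the bound for rank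
at most 5. -/
theorem mul_bounds (hc₁ : c₁ ≤ 7 * m) (hc₂ : 2 ≤ c₂) (hs : 45 * (c₂ : ℝ) * (m : ℝ) ^ 3 ≤ E.s) :
    (m : ℝ) ^ 2 * c₁ ≤ 7 * (E.s / 90) ∧ (m : ℝ) ^ 2 * c₂ ≤ E.s / 45 ∧
      (m : ℝ) ^ 2 * c₁ * c₂ ≤ 7 * (E.s / 45) ∧ (m : ℝ) ^ 2 ≤ E.s / 90 := by
  have hm := E.one_le_cast
  have h1 : (c₁ : ℝ) ≤ 7 * m := by exact_mod_cast hc₁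
  have h2 : (2 : ℝ) ≤ c₂ := by exact_mod_cast hc₂
  have h3 : (m : ℝ) ^ 2 ≤ (m : ℝ) ^ 3 := pow_le_pow_right₀ hm (by norm_num)
  have h4 : (m : ℝ) ^ 2 * c₁ ≤ 7 * (m : ℝ) ^ 3 :=
    calc (m : ℝ) ^ 2 * c₁ ≤ (m : ℝ) ^ 2 * (7 * m) := by gcongr
      _ = _ := by ring
  have h5 : (m : ℝ) ^ 3 * 2 ≤ (m : ℝ) ^ 3 * c₂ := by gcongr
  have h6 : (m : ℝ) ^ 2 * c₂ ≤ (m : ℝ) ^ 3 * c₂ := by gcongr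
  have h7 : (m : ℝ) ^ 2 * c₁ * c₂ ≤ 7 * (m : ℝ) ^ 3 * c₂ := by gcongr
  refine ⟨?_, ?_, ?_, ?_⟩ <;> linarith

theorem forall_lt_sq_fin_three_of_large (hc₁ : c₁ ≤ 7 * m) (hc₂ : 2 ≤ c₂)
    (hs : 45 * (c₂ : ℝ) * (m : ℝ) ^ 3 ≤ E.s) (i j : Fin 3) :
    ![1, 2, c₁] i = ![1, 2, c₁] j ∨
      4 * (m : ℝ) ^ 2 * (![1, 2, c₁] i : ℕ) * (![1, 2, c₁] j : ℕ) < E.s ^ 2 := by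
  have h := (E.mul_bounds hc₁ hc₂ hs).1
  have := E.s_pos
  exact E.forall_lt_sq_fin_three (E.lt_sq_of_le (by linarith)) i j

theorem lt_of_rank_le_five [CharZero F] [FiniteDimensional F V] (hc₁0 : 2 ≤ c₁)
    (hc₁ : c₁ ≤ 7 * m) (hc₂ : 2 ≤ c₂)
    (hF : E.Admissible ![1, 2, c₁]) (hG : (E.gramG ![1, 2, c₂]).det ≠ 0)
    (hr : L.rank ≤ 5) : E.s < 45 * (c₂ : ℝ) * (m : ℝ) ^ 3 := by
  by_contra! hs
  obtain ⟨h1, h2, h3, h4⟩ := E.mul_bounds hc₁ hc₂ hs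
  have hs0 := E.s_pos
  have hlt := E.forall_lt_sq_fin_three_of_large hc₁ hc₂ hs
  have := E.card_add_card_le_rank (forall_fin_three (by omega)) hlt
    (k := ![1, 2, c₂]) (forall_fin_three (by omega)) (fun i j => by
      fin_cases i <;> fin_cases j <;> simp <;> linarith) (hF hlt) (E.posDef_gramG_three hc₂ hs hG)
  simp at this
  omega

theorem lt_of_rank_le_six [CharZero F] [FiniteDimensional F V] {d₁ : ℕ} (hc₁0 : 2 ≤ c₁)
    (hc₁ : c₁ ≤ 7 * m) (hc₂ : 2 ≤ c₂) (hd₁ : 1 ≤ d₁)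
    (hF : E.Admissible ![1, 2, c₁, d₁]) (hG : (E.gramG ![1, 2, c₂]).det ≠ 0)
    (hr : L.rank ≤ 6) : E.s < max (45 * (c₂ : ℝ) * (m : ℝ) ^ 3)
      (5 * (d₁ : ℝ) * max (c₁ : ℝ) (c₂ : ℝ) * (m : ℝ) ^ 2) := by
  by_contra! hs
  obtain ⟨hs, hs'⟩ := max_le_iff.1 hs
  obtain ⟨h1, h2, h3, h4⟩ := E.mul_bounds hc₁ hc₂ hs
  have hs0 := E.s_pos
  have h5 : (m : ℝ) ^ 2 * c₁ * d₁ ≤ E.s / 5 := by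
    have : (m : ℝ) ^ 2 * c₁ * d₁ ≤ (m : ℝ) ^ 2 * max (c₁ : ℝ) (c₂ : ℝ) * d₁ := by
      gcongr; exact le_max_left _ _
    linarith
  have h6 : (m : ℝ) ^ 2 * c₂ * d₁ ≤ E.s / 5 := by
    have : (m : ℝ) ^ 2 * c₂ * d₁ ≤ (m : ℝ) ^ 2 * max (c₁ : ℝ) (c₂ : ℝ) * d₁ := by
      gcongr; exact le_max_right _ _
    linarith
  have h7 : (m : ℝ) ^ 2 * 2 * d₁ ≤ (m : ℝ) ^ 2 * c₂ * d₁ := by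
    gcongr; exact_mod_cast hc₂
  have h8 : (0 : ℝ) ≤ (m : ℝ) ^ 2 * d₁ := by positivity
  have hlt := E.forall_lt_sq_fin_four (c := c₁) (d := d₁) (E.lt_sq_of_le (by linarith))
    (E.lt_sq_of_le (by linarith)) (E.lt_sq_of_le (by linarith))
  have := E.card_add_card_le_rank (forall_fin_four (by omega) hd₁) hlt
    (k := ![1, 2, c₂]) (forall_fin_three (by omega)) (fun i j => by
      fin_cases i <;> fin_cases j <;> simp <;> linarith) (hF hlt) (E.posDef_gramG_three hc₂ hs hG)
  simp at this
  omega

theorem lt_of_rank_le_seven [CharZero F] [FiniteDimensional F V] {d₁ d₂ : ℕ} (hc₁0 : 2 ≤ c₁)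
    (hc₂ : 2 ≤ c₂) (hd₁ : 1 ≤ d₁) (hd₂ : 1 ≤ d₂)
    (hF : E.Admissible ![1, 2, c₁, d₁]) (hG : (E.gramG ![1, 2, c₂, d₂]).det ≠ 0)
    (hr : L.rank ≤ 7) : E.s <
      max (5 * max (c₁ : ℝ) (d₁ : ℝ) * max (c₂ : ℝ) (d₂ : ℝ) * (m : ℝ) ^ 2)
        (200 * (c₂ : ℝ) * (d₂ : ℝ) * (m : ℝ) ^ 4) := by
  by_contra! hs
  obtain ⟨hs', hs⟩ := max_le_iff.1 hs
  have hs0 := E.s_pos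
  have h18 := E.hs
  have hm2 : (1 : ℝ) ≤ (m : ℝ) ^ 2 := one_le_pow₀ E.one_le_cast
  have key : ∀ x y : ℝ, 0 ≤ x → 0 ≤ y → x ≤ max (c₁ : ℝ) d₁ → y ≤ max (c₂ : ℝ) d₂ →
      (m : ℝ) ^ 2 * x * y ≤ E.s / 5 := fun x y hx hy hx' hy' => by
    have : (m : ℝ) ^ 2 * x * y ≤ (m : ℝ) ^ 2 * max (c₁ : ℝ) d₁ * max (c₂ : ℝ) d₂ := by gcongr
    linarith
  have k₁ : (2 : ℝ) ≤ max (c₁ : ℝ) d₁ := le_max_of_le_left (by exact_mod_cast hc₁0)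
  have k₂ : (2 : ℝ) ≤ max (c₂ : ℝ) d₂ := le_max_of_le_left (by exact_mod_cast hc₂)
  have hc1 : (0 : ℝ) ≤ c₁ := by positivity
  have hc2 : (0 : ℝ) ≤ c₂ := by positivity
  have hd1 : (0 : ℝ) ≤ d₁ := by positivity
  have hd2 : (0 : ℝ) ≤ d₂ := by positivity
  have e1 := key _ _ hc1 hc2 (le_max_left _ _) (le_max_left _ _)
  have e2 := key _ _ hc1 hd2 (le_max_left _ _) (le_max_right _ _)
  have e3 := key _ _ hd1 hc2 (le_max_right _ _) (le_max_left _ _)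
  have e4 := key _ _ hd1 hd2 (le_max_right _ _) (le_max_right _ _)
  have e5 := key _ _ hc1 zero_le_two (le_max_left _ _) k₂
  have e6 := key _ _ hd1 zero_le_two (le_max_right _ _) k₂
  have e7 := key _ _ zero_le_two hc2 k₁ (le_max_left _ _)
  have e8 := key _ _ zero_le_two hd2 k₁ (le_max_right _ _)
  have p1 : (0 : ℝ) ≤ (m : ℝ) ^ 2 * c₁ := by positivity
  have p2 : (0 : ℝ) ≤ (m : ℝ) ^ 2 * d₁ := by positivity
  have p3 : (0 : ℝ) ≤ (m : ℝ) ^ 2 * c₂ := by positivity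
  have p4 : (0 : ℝ) ≤ (m : ℝ) ^ 2 * d₂ := by positivity
  -- Products inside the f-block only have to stay below s², so separate linear bounds on c₁ and d₁
  -- suffice.
  have hcd : 4 * (m : ℝ) ^ 2 * c₁ * d₁ < E.s ^ 2 := by
    have h1 : ((m : ℝ) ^ 2 * c₁) * ((m : ℝ) ^ 2 * d₁) ≤ (E.s / 10) * (E.s / 10) := by
      apply mul_le_mul _ _ p2 (by linarith) <;> linarith
    have h2 : (m : ℝ) ^ 2 * c₁ * d₁ * 1 ≤ (m : ℝ) ^ 2 * c₁ * d₁ * (m : ℝ) ^ 2 := by gcongr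
    nlinarith
  have hlt := E.forall_lt_sq_fin_four (c := c₁) (d := d₁) (E.lt_sq_of_le (by linarith))
    (E.lt_sq_of_le (by linarith)) hcd
  have := E.card_add_card_le_rank (forall_fin_four (by omega) hd₁) hlt
    (k := ![1, 2, c₂, d₂]) (forall_fin_four (by omega) hd₂) (fun i j => by
      fin_cases i <;> fin_cases j <;> simp <;> linarith) (hF hlt)
    (E.posDef_gramG_four hc₂ hd₂ hs hG)
  simp at this
  omega

end Large

theorem exists_constants [CharZero F] [FiniteDimensional F V] :
    ∃ p₁ p₂ C₁ C₂ q₁ q₂ D₁ D₂ : ℕ,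
      (p₁.Prime ∧ p₁ ≤ 2 * m ^ 2) ∧ (p₂.Prime ∧ p₂ ≤ 2 * m ^ 2) ∧
      (2 ≤ C₁ ∧ C₁ ≤ leastNonresidue p₁) ∧ (2 ≤ C₂ ∧ C₂ ≤ leastNonresidue p₂) ∧
      (q₁.Prime ∧ q₁ ≤ 2 * C₁ * m ^ 3) ∧ (q₂.Prime ∧ q₂ ≤ 2 * C₂ * m ^ 3) ∧
      (1 ≤ D₁ ∧ D₁ ≤ q₁ * leastNonresidue q₁) ∧ (1 ≤ D₂ ∧ D₂ ≤ q₂ * leastNonresidue q₂) ∧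
      (L.rank ≤ 3 → E.s < 5 * (C₁ : ℝ) * (m : ℝ) ^ 2) ∧
      (L.rank ≤ 4 → E.s < 9 * (C₁ : ℝ) * (m : ℝ) ^ 2) ∧
      (L.rank ≤ 5 → E.s < 45 * (C₂ : ℝ) * (m : ℝ) ^ 3) ∧
      (L.rank ≤ 6 → E.s <
        max (45 * (C₂ : ℝ) * (m : ℝ) ^ 3)
          (5 * (D₁ : ℝ) * max (C₁ : ℝ) (C₂ : ℝ) * (m : ℝ) ^ 2)) ∧
      (L.rank ≤ 7 → E.s <
        max (5 * max (C₁ : ℝ) (D₁ : ℝ) * max (C₂ : ℝ) (D₂ : ℝ) * (m : ℝ) ^ 2)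
          (200 * (C₂ : ℝ) * (D₂ : ℝ) * (m : ℝ) ^ 4)) := by
  obtain ⟨p₁, C₁, hp₁, hpm₁, hC₁, hCp₁, hCm₁, hA⟩ :=
    exists_prime_det_fin_three_ne_zero E.hm E.a_one_two_sq_lt
  obtain ⟨p₂, C₂, hp₂, hpm₂, hC₂, hCp₂, -, hY⟩ :=
    exists_prime_det_fin_three_ne_zero E.hm E.y_one_two_sq_lt
  have hC₁0 : 0 < C₁ := by omega
  have hC₂0 : 0 < C₂ := by omega
  have hF3 : E.Admissible ![1, 2, C₁] := fun h =>
    hA (E.gramF ![1, 2, C₁]) (E.gramF_isSymm (forall_fin_three hC₁0) h)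
      ((E.a_self one_pos).trans (by simp)) ((E.a_self two_pos).trans (by simp)) rfl
      (E.a_self hC₁0)
  have hG3 : (E.gramG ![1, 2, C₂]).det ≠ 0 :=
    hY (E.gramG ![1, 2, C₂]) (E.gramG_isSymm _)
      ((E.y_self one_pos).trans (by simp)) ((E.y_self two_pos).trans (by simp)) rfl
      (E.y_self hC₂0)
  have hm3 : 1 ≤ m ^ 3 := Nat.one_le_pow _ _ E.hm
  -- Below this threshold the bounds for ranks 5, 6 and 7 hold outright, with placeholders q = 2 and
  -- D = 1. Above it both 3 × 3 determinants are positive, as the choice of D₁ and D₂ requires.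
  rcases lt_or_ge E.s (45 * (C₂ : ℝ) * (m : ℝ) ^ 3) with hs | hs
  · have h2 : ∀ {C : ℕ}, 2 ≤ C → 2 ≤ 2 * C * m ^ 3 := fun h => by nlinarith
    have hγ : 1 ≤ 2 * leastNonresidue 2 := by simp [leastNonresidue]
    refine ⟨p₁, p₂, C₁, C₂, 2, 2, 1, 1, ⟨hp₁, hpm₁⟩, ⟨hp₂, hpm₂⟩, ⟨hC₁, hCp₁⟩, ⟨hC₂, hCp₂⟩,
      ⟨Nat.prime_two, h2 hC₁⟩, ⟨Nat.prime_two, h2 hC₂⟩, ⟨le_rfl, hγ⟩, ⟨le_rfl, hγ⟩,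
      E.lt_of_rank_le_three hC₁ hF3, E.lt_of_rank_le_four hC₁ hF3, fun _ => hs,
      fun _ => lt_max_of_lt_left hs, fun _ => lt_max_of_lt_right (hs.trans_le ?_)⟩
    have h3 : (m : ℝ) ^ 3 ≤ (m : ℝ) ^ 4 := pow_le_pow_right₀ E.one_le_cast (by norm_num)
    rw [Nat.cast_one, mul_one]
    gcongr
    norm_num
  · have hlt := E.forall_lt_sq_fin_three_of_large hCm₁ hC₂ hs
    have hdetF : 0 < (E.gramF ![1, 2, C₁]).det :=
      lt_of_le_of_ne (E.gramF_det_nonneg (forall_fin_three hC₁0) hlt) (hF3 hlt).symm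
    have hdetG : 0 < (E.gramG ![1, 2, C₂]).det := by
      have h0 := (E.posDef_gramG_three hC₂ hs hG3).det_pos
      have h1 : ((E.gramG ![1, 2, C₂]).map (Int.cast : ℤ → ℝ)).det =
          (E.gramG ![1, 2, C₂]).det := by
        rw [Int.cast_det]
      rw [h1] at h0
      exact_mod_cast h0
    obtain ⟨q₁, D₁, hq₁, hqm₁, hD₁, hDq₁, hA4⟩ := exists_prime_det_fin_four_ne_zero E.hm hC₁0
      (E.gramF_isSymm (forall_fin_three hC₁0) hlt)
      ((E.a_self one_pos).trans (by simp)) ((E.a_self two_pos).trans (by simp))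
      (E.a_self hC₁0) E.a_one_two_sq_lt hdetF
    obtain ⟨q₂, D₂, hq₂, hqm₂, hD₂, hDq₂, hY4⟩ := exists_prime_det_fin_four_ne_zero E.hm hC₂0
      (E.gramG_isSymm ![1, 2, C₂])
      ((E.y_self one_pos).trans (by simp)) ((E.y_self two_pos).trans (by simp))
      (E.y_self hC₂0) E.y_one_two_sq_lt hdetG
    have hF4 : E.Admissible ![1, 2, C₁, D₁] := fun h =>
      hA4 (E.gramF ![1, 2, C₁, D₁]) (E.gramF_isSymm (forall_fin_four hC₁0 hD₁) h)
        (by ext i j; fin_cases i <;> fin_cases j <;> rfl) (E.a_self hD₁)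
    have hG4 : (E.gramG ![1, 2, C₂, D₂]).det ≠ 0 :=
      hY4 (E.gramG ![1, 2, C₂, D₂]) (E.gramG_isSymm _)
        (by ext i j; fin_cases i <;> fin_cases j <;> rfl) (E.y_self hD₂)
    exact ⟨p₁, p₂, C₁, C₂, q₁, q₂, D₁, D₂, ⟨hp₁, hpm₁⟩, ⟨hp₂, hpm₂⟩, ⟨hC₁, hCp₁⟩, ⟨hC₂, hCp₂⟩,
      ⟨hq₁, hqm₁⟩, ⟨hq₂, hqm₂⟩, ⟨hD₁, hDq₁⟩, ⟨hD₂, hDq₂⟩,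
      E.lt_of_rank_le_three hC₁ hF3, E.lt_of_rank_le_four hC₁ hF3,
      E.lt_of_rank_le_five hC₁ hCm₁ hC₂ hF3 hG3, E.lt_of_rank_le_six hC₁ hCm₁ hC₂ hD₁ hF4 hG3,
      E.lt_of_rank_le_seven hC₁ hC₂ hD₁ hD₂ hF4 hG4⟩

end Frame

end QuadLattice

theorem mainTheorem4 (m D : ℕ) (hm : 0 < m) (hD : 0 < D) (hD1 : D ≠ 1) (hDsq : Squarefree D)
    {V : Type*} [AddCommGroup V] [Module (QuadField D) V] [FiniteDimensional (QuadField D) V]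
    [Module (𝓞 (QuadField D)) V] [IsScalarTower (𝓞 (QuadField D)) (QuadField D) V]
    (Q : QuadraticForm (QuadField D) V) (L : QuadLattice (QuadField D) Q)
    (hclassical : L.IsClassical) (hpos : L.IsTotallyPosDef)
    (hrep : ∀ α : 𝓞 (QuadField D), IsTotallyPos (α : QuadField D) →
      L.Represents ((m : QuadField D) * (α : QuadField D))) :
    ∃ p₁ p₂ C₁ C₂ q₁ q₂ D₁ D₂ : ℕ,
      (p₁.Prime ∧ p₁ ≤ 2 * m ^ 2) ∧ (p₂.Prime ∧ p₂ ≤ 2 * m ^ 2) ∧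
      (2 ≤ C₁ ∧ C₁ ≤ leastNonresidue p₁) ∧ (2 ≤ C₂ ∧ C₂ ≤ leastNonresidue p₂) ∧
      (q₁.Prime ∧ q₁ ≤ 2 * C₁ * m ^ 3) ∧ (q₂.Prime ∧ q₂ ≤ 2 * C₂ * m ^ 3) ∧
      (1 ≤ D₁ ∧ D₁ ≤ q₁ * leastNonresidue q₁) ∧ (1 ≤ D₂ ∧ D₂ ≤ q₂ * leastNonresidue q₂) ∧
      (L.rank ≤ 3 → √(quadDisc D : ℝ) < 5 * (C₁ : ℝ) * (m : ℝ) ^ 2) ∧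
      (L.rank ≤ 4 → √(quadDisc D : ℝ) < 9 * (C₁ : ℝ) * (m : ℝ) ^ 2) ∧
      (L.rank ≤ 5 → √(quadDisc D : ℝ) < 45 * (C₂ : ℝ) * (m : ℝ) ^ 3) ∧
      (L.rank ≤ 6 → √(quadDisc D : ℝ) <
        max (45 * (C₂ : ℝ) * (m : ℝ) ^ 3)
          (5 * (D₁ : ℝ) * max (C₁ : ℝ) (C₂ : ℝ) * (m : ℝ) ^ 2)) ∧
      (L.rank ≤ 7 → √(quadDisc D : ℝ) <
        max (5 * max (C₁ : ℝ) (D₁ : ℝ) * max (C₂ : ℝ) (D₂ : ℝ) * (m : ℝ) ^ 2)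
          (200 * (C₂ : ℝ) * (D₂ : ℝ) * (m : ℝ) ^ 4)) := by
  -- For s < 18m² all bounds hold with p = 2 and C = γ_2 = 7, since already 5 · 7 > 18. A frame may
  -- therefore assume s ≥ 18m².
  rcases lt_or_ge √(quadDisc D : ℝ) (18 * (m : ℝ) ^ 2) with hs | hs
  · have hm2 : (1 : ℝ) ≤ m := by exact_mod_cast hm
    have hm1 : (1 : ℝ) ≤ (m : ℝ) ^ 2 := one_le_pow₀ hm2
    have hm3 : (m : ℝ) ^ 2 ≤ (m : ℝ) ^ 3 := pow_le_pow_right₀ hm2 (by norm_num)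
    have hm4 : (m : ℝ) ^ 2 ≤ (m : ℝ) ^ 4 := pow_le_pow_right₀ hm2 (by norm_num)
    have hN2 : 1 ≤ m ^ 2 := Nat.one_le_pow _ _ hm
    have hN3 : 1 ≤ m ^ 3 := Nat.one_le_pow _ _ hm
    have hγ : leastNonresidue 2 = 7 := by simp [leastNonresidue]
    have h45 : √(quadDisc D : ℝ) < 45 * (7 : ℕ) * (m : ℝ) ^ 3 := by push_cast; linarith
    refine ⟨2, 2, 7, 7, 2, 2, 1, 1, ⟨Nat.prime_two, by omega⟩, ⟨Nat.prime_two, by omega⟩,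
      ⟨by norm_num, hγ.ge⟩, ⟨by norm_num, hγ.ge⟩, ⟨Nat.prime_two, by omega⟩,
      ⟨Nat.prime_two, by omega⟩, ⟨le_rfl, by omega⟩, ⟨le_rfl, by omega⟩, fun _ => ?_, fun _ => ?_,
      fun _ => h45, fun _ => lt_max_of_lt_left h45, fun _ => lt_max_of_lt_right ?_⟩ <;>
    · push_cast; linarith
  · have hD : Irrational √(D : ℝ) := QuadField.irrational_sqrt hD1 hDsq
    obtain ⟨σ, hσ⟩ := QuadField.exists_conj hD
    obtain ⟨α, hα, hsub, hα0, hα1⟩ := QuadField.exists_totallyPos hσ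
    obtain ⟨E, hE⟩ := QuadLattice.exists_frame hpos hclassical hm
      (σ₁ := (algebraMap (QuadField D) ℝ)) (σ₂ := σ) hs
      (QuadField.exists_int_sub_conj hDsq hD hσ) (QuadField.exists_int_of_eq_conj hD hσ)
      hsub hα0 hα1
      (fun n hn => by
        have h := hrep (n : 𝓞 (QuadField D)) (fun τ => by simpa using hn)
        push_cast at h ⊢
        exact h)
      (fun n hn => by
        have h := hrep ((n : 𝓞 (QuadField D)) * α) (fun τ => by
          have := hα τ
          have hn' : (0 : ℝ) < n := by exact_mod_cast hn
          push_cast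
          rw [map_mul, map_natCast]
          positivity)
        push_cast at h ⊢
        rw [mul_assoc]
        exact h)
    rw [← hE]
    exact E.exists_constants
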